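/- Let $(R,\mathfrak m)$ be a Noetherian (commutative) local ring of dimension $d$ with infinite residue field. For a finitely generated $R$-module $M$ let $\nu(M)$ be its minimal number of generators, let $$e(\mathfrak m,M)=\lim_{k\to\infty}\frac{d!\,\mathrm{length}_R(M/\mathfrak m^kM)}{k^d}$$ be its Hilbert--Samuel multiplicity, and for a system of parameters $\underline x=x_1,\dots,x_d$ of $R$ let $$\chi_1(\underline x,M)=\sum_{i=1}^{d}(-1)^{i-1}\,\mathrm{length}_R\,H_i(\underline x,M),$$ where $H_i(\underline x,M)$ denotes Koszul homology. Let $(M_n)_{n\ge 0}$ be a weakly lim Cohen--Macaulay sequence over $R$, i.e. a sequence of finitely generated $R$-modules of dimension $d$ for which there exists a system of parameters $\underline x=x_1,\dots,x_d$ of $R$ such that $\chi_1(\underline x,M_n)=o(\nu(M_n))$ as $n\to\infty$. Then $$\liminf_{n\to\infty}\frac{e(\mathfrak m,M_n)}{\nu(M_n)}\ \ge\ 1 ;$$ in particular, whenever $\lim_{n\to\infty} e(\mathfrak m,M_n)/\nu(M_n)$ exists, it is at least $1$. -/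

import Mathlib

open CategoryTheory Filter Topology Asymptotics IsLocalRing

noncomputable section

namespace LimCM

universe u v

/-- The Krull dimension of `R` as a natural number (meaningful for Noetherian local rings, where
the dimension is finite). -/
def ringDim (R : Type u) [CommRing R] : ℕ :=
  ((ringKrullDim R).unbotD 0).toNat

/-- The minimal number of generators `ν(M)` of a finitely generated module. -/
def nu (R : Type u) [CommRing R] (M : Type v) [AddCommGroup M] [Module R M] : ℕ :=
  (⊤ : Submodule R M).spanFinrank

/-- The Hilbert--Samuel multiplicity `e(I, M) = lim_k d! · ℓ(M / I^k M) / k^d`, where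
`d = dim R`, of a finitely generated module over a Noetherian local ring with respect to an ideal
primary to the maximal ideal (the limit exists by the Hilbert--Samuel theorem). -/
def hilbertSamuelMultiplicity {R : Type u} [CommRing R] (I : Ideal R)
    (M : Type v) [AddCommGroup M] [Module R M] : ℝ :=
  limUnder atTop fun k : ℕ =>
    ((ringDim R).factorial : ℝ) *
      ((Module.length R (M ⧸ (I ^ k • ⊤ : Submodule R M))).toNat : ℝ) / (k : ℝ) ^ ringDim R

/-- The Koszul complex `K(x₁, …, x_d; M)`, as an iterated mapping cone:
`K(∅; M)` is `M` in degree `0`, and `K(x, x₂, …; M)` is the cone of multiplication by `x` on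
`K(x₂, …; M)`. It is graded cohomologically, so that the usual term `K_i` sits in degree `-i`. -/
def koszulComplex {R : Type u} [CommRing R] (M : ModuleCat.{v} R) :
    List R → CochainComplex (ModuleCat.{v} R) ℤ
  | [] => (HomologicalComplex.single (ModuleCat.{v} R) (ComplexShape.up ℤ) 0).obj M
  | x :: xs => CochainComplex.mappingCone (x • 𝟙 (koszulComplex M xs))

/-- The Koszul homology module `H_i(x₁, …, x_d; M)`. -/
def koszulHomology {R : Type u} [CommRing R] (xs : List R)
    (M : Type v) [AddCommGroup M] [Module R M] (i : ℕ) : ModuleCat.{v} R :=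
  (koszulComplex (ModuleCat.of R M) xs).homology (-(i : ℤ))

/-- The first higher Euler characteristic
`χ₁(x₁, …, x_d; M) = ∑_{i=1}^d (-1)^{i-1} ℓ(H_i(x₁, …, x_d; M))`
(all lengths are finite for a system of parameters and a finitely generated module). -/
def chiOne {R : Type u} [CommRing R] (xs : List R)
    (M : Type v) [AddCommGroup M] [Module R M] : ℤ :=
  ∑ i ∈ Finset.Icc 1 xs.length,
    (-1 : ℤ) ^ (i - 1) * ((Module.length R (koszulHomology xs M i)).toNat : ℤ)

/-- `x₁, …, x_d` is a system of parameters of the local ring `R`: `d = dim R` and the ideal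
`(x₁, …, x_d)` is primary to the maximal ideal. -/
def IsSystemOfParameters {R : Type u} [CommRing R] [IsLocalRing R] (xs : List R) : Prop :=
  (xs.length : WithBot ℕ∞) = ringKrullDim R ∧ (Ideal.ofList xs).radical = maximalIdeal R

/-- A sequence `(M_n)` of finitely generated modules of dimension `dim R` is weakly lim
Cohen--Macaulay if there is a system of parameters `x` with `χ₁(x, M_n) = o(ν(M_n))`. -/
structure IsWeaklyLimCohenMacaulay (R : Type u) [CommRing R] [IsLocalRing R]
    (M : ℕ → Type v) [∀ n, AddCommGroup (M n)] [∀ n, Module R (M n)] : Prop where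
  finite : ∀ n, Module.Finite R (M n)
  dim_eq : ∀ n, Module.supportDim R (M n) = ringKrullDim R
  exists_chiOne_isLittleO : ∃ xs : List R, IsSystemOfParameters xs ∧
    (fun n => (chiOne xs (M n) : ℝ)) =o[atTop] (fun n => (nu R (M n) : ℝ))

end LimCM

end

/-! The comparison is made between two systems of parameters. Write e(x|M) for the multiplicity
symbol defined by e(x, x'|M) = e(x'|M/xM) - e(x'|0 :_M x). By Serre, χ₁(x, M) = ℓ(M/xM) - e(x|M);
call this number the excess of x on M. By Samuel, e(x|M) is the normalized leading coefficient of k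
↦ ℓ(M/(x)^k M), so if y generates a reduction of 𝔪, then e(y|M) = e(𝔪, M). Nakayama gives ν(M) ≤
ℓ(M/yM) = e(𝔪, M) + χ₁(y, M).

The hypothesis concerns an arbitrary x, so χ₁(y, M) must be bounded by C χ₁(x, M) with C independent
of M. One parameter is exchanged at a time. In the last entry a, the excess is subadditive and
monotone under products: its recursion expresses it as symbols e(…, a|N), which are additive in a,
plus one length ℓ(0 :_N a). If a^t ≡ b r modulo the other entries, replacing a by b therefore costs
at most a factor t, and t depends only on the ring.

The reduction y must be reachable from x with every intermediate list still 𝔪-primary. As the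
residue field is infinite, each new entry can be chosen both superficial and outside finitely many
primes. This yields ν(M) - C χ₁(x, M) ≤ e(𝔪, M) for all finitely generated M
(`IsSystemOfParameters.exists_nu_sub_le`), and dividing by ν(M_n) finishes the proof. The main
ingredients are `multAdditive`, `mult_perm`, `mult_mul_cons`, `tendsto_hilbertFn`,
`exists_reduction`, `exists_excess_le` and `chiOne_eq_excess`. -/

namespace LimCM

universe u v

/-! ### The multiplicity symbol and the modules on which it is defined. -/

section Multiplicity

variable {R : Type u} [CommRing R]

/-- Northcott's multiplicity symbol of a list of elements on a module. -/
noncomputable def mult : List R → (M : Type v) → [AddCommGroup M] → [Module R M] → ℤ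
  | [], M, _, _ => ((Module.length R M).toNat : ℤ)
  | x :: xs, M, _, _ =>
    mult xs (M ⧸ LinearMap.range (LinearMap.lsmul R M x)) -
      mult xs (LinearMap.ker (LinearMap.lsmul R M x))

/-- `M` is finitely generated and some power of the maximal ideal lies in `(xs) + ann M`. -/
structure IsParam [IsLocalRing R] (xs : List R) (M : Type v) [AddCommGroup M] [Module R M] :
    Prop where
  finite : Module.Finite R M
  exists_pow_le : ∃ k, maximalIdeal R ^ k ≤ Ideal.ofList xs ⊔ Module.annihilator R M

variable {A B C : Type v} [AddCommGroup A] [AddCommGroup B] [AddCommGroup C]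
  [Module R A] [Module R B] [Module R C]

lemma annihilator_mul_annihilator_le (f : A →ₗ[R] B) (g : B →ₗ[R] C) (hfg : Function.Exact f g) :
    Module.annihilator R A * Module.annihilator R C ≤ Module.annihilator R B := by
  rw [Ideal.mul_le]
  intro a ha c hc
  rw [Module.mem_annihilator] at *
  intro b
  obtain ⟨y, hy⟩ := (hfg (c • b)).1 (by rw [map_smul, hc])
  rw [mul_smul, ← hy, ← map_smul, ha, map_zero]

lemma mem_annihilator_quotient_lsmul (x : R) :
    x ∈ Module.annihilator R (A ⧸ LinearMap.range (LinearMap.lsmul R A x)) := by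
  rw [Module.mem_annihilator]
  intro m
  obtain ⟨m, rfl⟩ := Submodule.mkQ_surjective _ m
  rw [← map_smul, Submodule.mkQ_apply, Submodule.Quotient.mk_eq_zero]
  exact ⟨m, rfl⟩

lemma mem_annihilator_ker_lsmul (x : R) :
    x ∈ Module.annihilator R (LinearMap.ker (LinearMap.lsmul R A x)) := by
  rw [Module.mem_annihilator]
  rintro ⟨m, hm⟩
  ext
  exact hm

lemma ofList_perm {xs ys : List R} (h : xs.Perm ys) : Ideal.ofList xs = Ideal.ofList ys := by
  unfold Ideal.ofList
  congr 1
  ext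
  exact h.mem_iff

lemma sup_mul_sup_le (I J K L : Ideal R) (h : J * K ≤ L) : (I ⊔ J) * (I ⊔ K) ≤ I ⊔ L := by
  rw [Ideal.sup_mul]
  refine sup_le (le_trans Ideal.mul_le_left le_sup_left) ?_
  rw [Ideal.mul_sup]
  exact sup_le (le_trans Ideal.mul_le_right le_sup_left) (h.trans le_sup_right)

section IsParam

variable [IsLocalRing R] {xs : List R}

lemma IsParam.of_injective [IsNoetherianRing R] (h : IsParam xs B) (f : A →ₗ[R] B)
    (hf : Function.Injective f) : IsParam xs A := by
  have := h.finite
  obtain ⟨k, hk⟩ := h.exists_pow_le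
  exact ⟨Module.Finite.of_injective f hf, k,
    hk.trans (sup_le_sup_left (f.annihilator_le_of_injective hf) _)⟩

lemma IsParam.of_surjective (h : IsParam xs A) (f : A →ₗ[R] B)
    (hf : Function.Surjective f) : IsParam xs B := by
  have := h.finite
  obtain ⟨k, hk⟩ := h.exists_pow_le
  exact ⟨Module.Finite.of_surjective f hf, k,
    hk.trans (sup_le_sup_left (f.annihilator_le_of_surjective hf) _)⟩

lemma IsParam.of_exact (hA : IsParam xs A) (hC : IsParam xs C) (f : A →ₗ[R] B) (g : B →ₗ[R] C)
    (hg : Function.Surjective g) (hfg : Function.Exact f g) : IsParam xs B := by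
  have := hA.finite
  have := hC.finite
  obtain ⟨k, hk⟩ := hA.exists_pow_le
  obtain ⟨l, hl⟩ := hC.exists_pow_le
  refine ⟨?_, k + l, ?_⟩
  · refine Module.finite_def.2 (Submodule.fg_of_fg_map_of_fg_inf_ker g ?_ ?_)
    · rw [Submodule.map_top, LinearMap.range_eq_top.2 hg]
      exact Module.Finite.fg_top
    · rw [top_inf_eq, LinearMap.exact_iff.mp hfg, ← Submodule.map_top]
      exact Module.Finite.fg_top.map f
  · rw [pow_add]
    exact (Ideal.mul_mono hk hl).trans
      (sup_mul_sup_le _ _ _ _ (annihilator_mul_annihilator_le f g hfg))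

lemma IsParam.of_cons {x : R} (h : IsParam (x :: xs) A) (hx : x ∈ Module.annihilator R A) :
    IsParam xs A := by
  obtain ⟨k, hk⟩ := h.exists_pow_le
  refine ⟨h.finite, k, hk.trans ?_⟩
  rw [Ideal.ofList_cons]
  exact sup_le (sup_le ((Ideal.span_singleton_le_iff_mem _).2
    (Ideal.mem_sup_right hx)) le_sup_left) le_sup_right

lemma IsParam.quotient {x : R} (h : IsParam (x :: xs) A) :
    IsParam xs (A ⧸ LinearMap.range (LinearMap.lsmul R A x)) :=
  (h.of_surjective _ (Submodule.mkQ_surjective _)).of_cons (mem_annihilator_quotient_lsmul x)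

lemma IsParam.ker [IsNoetherianRing R] {x : R} (h : IsParam (x :: xs) A) :
    IsParam xs (LinearMap.ker (LinearMap.lsmul R A x)) :=
  (h.of_injective _ (Submodule.subtype_injective _)).of_cons (mem_annihilator_ker_lsmul x)

lemma IsParam.mono {ys : List R} (h : IsParam xs A)
    (hle : Ideal.ofList xs ≤ Ideal.ofList ys ⊔ Module.annihilator R A) : IsParam ys A := by
  obtain ⟨k, hk⟩ := h.exists_pow_le
  exact ⟨h.finite, k, hk.trans (sup_le hle le_sup_right)⟩

lemma IsParam.perm {ys : List R} (h : IsParam xs A) (hp : xs.Perm ys) : IsParam ys A :=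
  h.mono ((ofList_perm hp).le.trans le_sup_left)

/-- The module lives over R / ann A, whose maximal ideal is nilpotent, so this Noetherian ring is
Artinian. -/
lemma isFiniteLength_of_pow_le_annihilator [IsNoetherianRing R] [Module.Finite R A] {k : ℕ}
    (hk : maximalIdeal R ^ k ≤ Module.annihilator R A) : IsFiniteLength R A := by
  rw [isFiniteLength_iff_isNoetherian_isArtinian]
  refine ⟨inferInstance, ?_⟩
  let I := Module.annihilator R A
  by_cases hI : I = ⊤
  · rw [Module.annihilator_eq_top_iff] at hI
    infer_instance
  have : Nontrivial (R ⧸ I) := Ideal.Quotient.nontrivial_iff.2 hI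
  have : IsLocalRing (R ⧸ I) := .of_surjective' _ Ideal.Quotient.mk_surjective
  have hart : IsArtinianRing (R ⧸ I) := by
    rw [isArtinianRing_iff_isNilpotent_maximalIdeal]
    refine ⟨k, ?_⟩
    have : maximalIdeal (R ⧸ I) = (maximalIdeal R).map (Ideal.Quotient.mk I) :=
      (IsLocalRing.map_maximalIdeal_of_surjective _ Ideal.Quotient.mk_surjective).symm
    rw [this, ← Ideal.map_pow]
    exact (Ideal.map_eq_bot_iff_le_ker _).2 (by rwa [Ideal.mk_ker])
  let _ : Module (R ⧸ I) A := Module.quotientAnnihilator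
  have : IsScalarTower R (R ⧸ I) A := by
    refine ⟨fun r s m => ?_⟩
    obtain ⟨s, rfl⟩ := Ideal.Quotient.mk_surjective s
    exact mul_smul r s m
  have : Module.Finite (R ⧸ I) A := Module.Finite.of_restrictScalars_finite R _ _
  have : IsArtinian (R ⧸ I) A := inferInstance
  exact (isArtinian_of_surjective_algebraMap (S := R) (R := R ⧸ I)
    Ideal.Quotient.mk_surjective)

lemma IsParam.isFiniteLength [IsNoetherianRing R] (h : IsParam ([] : List R) A) : IsFiniteLength R A := by
  have := h.finite
  obtain ⟨k, hk⟩ := h.exists_pow_le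
  exact isFiniteLength_of_pow_le_annihilator (k := k) (by simpa using hk)

end IsParam

end Multiplicity

/-! ### Additivity of the symbol on short exact sequences. -/

section Additivity

variable {R : Type u} [CommRing R] [IsLocalRing R] [IsNoetherianRing R]

/-- The symbol `mult xs` is additive on short exact sequences of parameter modules. -/
def MultAdditive (xs : List R) : Prop :=
  ∀ {A B C : Type v} [AddCommGroup A] [AddCommGroup B] [AddCommGroup C]
    [Module R A] [Module R B] [Module R C] (f : A →ₗ[R] B) (g : B →ₗ[R] C),
    IsParam xs B → Function.Injective f → Function.Surjective g → Function.Exact f g →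
    mult xs B = mult xs A + mult xs C

variable {A B C D E F : Type v} [AddCommGroup A] [AddCommGroup B] [AddCommGroup C]
  [AddCommGroup D] [AddCommGroup E] [AddCommGroup F]
  [Module R A] [Module R B] [Module R C] [Module R D] [Module R E] [Module R F]
  {xs : List R}

namespace MultAdditive

omit [IsNoetherianRing R]

lemma mult_punit (H : MultAdditive.{u, v} xs) : mult xs PUnit.{v + 1} = 0 := by
  have : IsParam xs PUnit.{v + 1} := by
    refine ⟨inferInstance, 0, ?_⟩
    have : Module.annihilator R PUnit.{v + 1} = ⊤ := Module.annihilator_eq_top_iff.2 inferInstance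
    simp [this]
  have h := H (0 : PUnit.{v + 1} →ₗ[R] PUnit.{v + 1}) (0 : PUnit.{v + 1} →ₗ[R] PUnit.{v + 1})
    this (Function.injective_of_subsingleton _) (Function.surjective_to_subsingleton _)
    (fun y => by simp)
  omega

/-- Invariance under isomorphism is additivity for 0 → A → B → 0 → 0. -/
lemma mult_congr (H : MultAdditive.{u, v} xs) (e : A ≃ₗ[R] B) (hB : IsParam xs B) :
    mult xs A = mult xs B := by
  have h := H (e : A →ₗ[R] B) (0 : B →ₗ[R] PUnit.{v + 1}) hB e.injective
    (Function.surjective_to_subsingleton _) (fun y => by simp)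
  rw [h, H.mult_punit, add_zero]

lemma mult_eq_add_range (H : MultAdditive.{u, v} xs) (f : A →ₗ[R] B) (g : B →ₗ[R] C)
    (hB : IsParam xs B) (h : Function.Exact f g) :
    mult xs B = mult xs (LinearMap.range f) + mult xs (LinearMap.range g) := by
  refine H (LinearMap.range f).subtype g.rangeRestrict hB (Submodule.subtype_injective _)
    g.surjective_rangeRestrict ?_
  rw [LinearMap.exact_iff] at *
  rw [LinearMap.ker_rangeRestrict, Submodule.range_subtype, h]

lemma mult_range_of_injective (H : MultAdditive.{u, v} xs) (f : A →ₗ[R] B) (hA : IsParam xs A)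
    (hf : Function.Injective f) : mult xs (LinearMap.range f) = mult xs A :=
  H.mult_congr (LinearEquiv.ofInjective f hf).symm hA

lemma mult_range_of_surjective (H : MultAdditive.{u, v} xs) (f : A →ₗ[R] B) (hB : IsParam xs B)
    (hf : Function.Surjective f) : mult xs (LinearMap.range f) = mult xs B :=
  H.mult_congr (LinearEquiv.ofTop _ (LinearMap.range_eq_top.2 hf)) hB

/-- The alternating sum over a six-term exact sequence vanishes. The terms are grouped in the
cokernel-minus-kernel form of the recursion for `mult`. -/
lemma mult_exact_six (H : MultAdditive.{u, v} xs) (f : A →ₗ[R] B) (g : B →ₗ[R] C)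
    (h : C →ₗ[R] D) (i : D →ₗ[R] E) (j : E →ₗ[R] F)
    (hA : IsParam xs A) (hB : IsParam xs B) (hC : IsParam xs C) (hD : IsParam xs D)
    (hE : IsParam xs E) (hF : IsParam xs F) (hf : Function.Injective f)
    (hfg : Function.Exact f g) (hgh : Function.Exact g h) (hhi : Function.Exact h i)
    (hij : Function.Exact i j) (hj : Function.Surjective j) :
    mult xs E - mult xs B = (mult xs D - mult xs A) + (mult xs F - mult xs C) := by
  rw [H.mult_eq_add_range f g hB hfg, H.mult_eq_add_range g h hC hgh,
    H.mult_eq_add_range h i hD hhi, H.mult_eq_add_range i j hE hij,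
    H.mult_range_of_injective f hA hf, H.mult_range_of_surjective j hF hj]
  ring

end MultAdditive

open LinearMap in
-- Multiplication by x acts on the whole short exact sequence; the snake lemma yields a six-term
-- sequence of kernels and cokernels, to which the induction hypothesis for the tail applies.
theorem multAdditive (xs : List R) : MultAdditive.{u, v} xs := by
  induction xs with
  | nil =>
    intro A B C _ _ _ _ _ _ f g hB hf hg hfg
    have h := Module.length_eq_add_of_exact f g hf hg hfg
    have hA := Module.length_ne_top_iff.2 (hB.of_injective f hf).isFiniteLength
    have hC := Module.length_ne_top_iff.2 (hB.of_surjective g hg).isFiniteLength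
    simp only [mult]
    rw [h, ENat.toNat_add hA hC]
    push_cast
    rfl
  | cons x xs H =>
    intro A B C _ _ _ _ _ _ f g hB hf hg hfg
    have hA := hB.of_injective f hf
    have hC := hB.of_surjective g hg
    simp only [mult]
    have h₁ : f.comp (lsmul R A x) = (lsmul R B x).comp f := by ext; simp
    have h₂ : g.comp (lsmul R B x) = (lsmul R C x).comp g := by ext; simp
    let F₁ : ker (lsmul R A x) →ₗ[R] ker (lsmul R B x) :=
      f.restrict (fun a ha => by simp_all [← map_smul])
    let F₂ : ker (lsmul R B x) →ₗ[R] ker (lsmul R C x) :=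
      g.restrict (fun a ha => by simp_all [← map_smul])
    let G₁ : (A ⧸ range (lsmul R A x)) →ₗ[R] (B ⧸ range (lsmul R B x)) :=
      Submodule.mapQ _ _ f (by rintro _ ⟨a, rfl⟩; exact ⟨f a, by simp⟩)
    let G₂ : (B ⧸ range (lsmul R B x)) →ₗ[R] (C ⧸ range (lsmul R C x)) :=
      Submodule.mapQ _ _ g (by rintro _ ⟨a, rfl⟩; exact ⟨g a, by simp⟩)
    let δ := SnakeLemma.δ' (lsmul R A x) (lsmul R B x) (lsmul R C x) f g hfg f g hfg h₁ h₂
      (ker (lsmul R C x)).subtype (exact_subtype_ker_map _)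
      (range (lsmul R A x)).mkQ (exact_map_mkQ_range _) hg hf
    refine H.mult_exact_six F₁ F₂ δ G₁ G₂ hA.ker hB.ker hC.ker hA.quotient hB.quotient hC.quotient
      ?_ ?_ ?_ ?_ ?_ ?_
    · intro a b hab
      exact Subtype.ext (hf (congrArg Subtype.val hab))
    · rintro ⟨b, hb⟩
      constructor
      · intro h
        obtain ⟨a, rfl⟩ := (hfg b).1 (congrArg Subtype.val h)
        refine ⟨⟨a, hf ?_⟩, rfl⟩
        simpa using hb
      · rintro ⟨a, ha⟩
        rw [← ha]
        exact Subtype.ext (hfg.apply_apply_eq_zero _)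
    · exact SnakeLemma.exact_δ'_right _ _ _ _ _ _ _ _ _ _ _ (ker (lsmul R B x)).subtype
        (exact_subtype_ker_map _) _ _ _ _ _ _ F₂ rfl (Submodule.subtype_injective _)
    · exact SnakeLemma.exact_δ'_left _ _ _ _ _ _ _ _ _ _ _ _ _ _ _
        (range (lsmul R B x)).mkQ (exact_map_mkQ_range _) _ _ G₁ rfl (Submodule.mkQ_surjective _)
    · intro b
      obtain ⟨b, rfl⟩ := Submodule.mkQ_surjective _ b
      constructor
      · intro h
        obtain ⟨c, hc⟩ := (Submodule.Quotient.mk_eq_zero _).1 h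
        obtain ⟨b', rfl⟩ := hg c
        obtain ⟨a, ha⟩ := (hfg (b - x • b')).1 (by simpa [sub_eq_zero] using hc.symm)
        refine ⟨Submodule.mkQ _ a, ?_⟩
        refine ((Submodule.Quotient.eq _).2 ?_)
        exact ⟨-b', by simp [ha]⟩
      · rintro ⟨a, ha⟩
        obtain ⟨a, rfl⟩ := Submodule.mkQ_surjective _ a
        rw [← ha]
        change Submodule.mkQ _ (g (f a)) = 0
        rw [hfg.apply_apply_eq_zero, map_zero]
    · intro c
      obtain ⟨c, rfl⟩ := Submodule.mkQ_surjective _ c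
      obtain ⟨b, rfl⟩ := hg c
      exact ⟨Submodule.mkQ _ b, rfl⟩

lemma mult_congr (e : A ≃ₗ[R] B) (hB : IsParam xs B) : mult xs A = mult xs B :=
  MultAdditive.mult_congr (multAdditive xs) e hB

lemma mult_eq_add (f : A →ₗ[R] B) (g : B →ₗ[R] C) (hB : IsParam xs B)
    (hf : Function.Injective f) (hg : Function.Surjective g) (hfg : Function.Exact f g) :
    mult xs B = mult xs A + mult xs C :=
  multAdditive xs f g hB hf hg hfg

end Additivity

/-! ### Dependence of the symbol on its entries: order, congruence, products. -/

section Permutation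

variable {R : Type u} [CommRing R]

lemma mem_ker_lsmul {M : Type v} [AddCommGroup M] [Module R M] {x : R} {m : M} :
    m ∈ LinearMap.ker (LinearMap.lsmul R M x) ↔ x • m = 0 := Iff.rfl

section HOne

variable (x y : R) (M : Type v) [AddCommGroup M] [Module R M]

/-- The one-cycles `{(a, b) | x a + y b = 0}` of the Koszul complex on two elements. -/
abbrev cyclesOne : Submodule R (M × M) :=
  LinearMap.ker ((LinearMap.lsmul R M x).coprod (LinearMap.lsmul R M y))

/-- The boundary map `c ↦ (y c, - x c)` into the one-cycles. -/
def toCyclesOne : M →ₗ[R] cyclesOne x y M :=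
  ((LinearMap.lsmul R M y).prod (-LinearMap.lsmul R M x)).codRestrict _ (fun c => by
    simp [smul_smul, mul_comm])

/-- The first Koszul homology of two elements. -/
abbrev hOne : Type v := cyclesOne x y M ⧸ LinearMap.range (toCyclesOne x y M)

lemma mk_hOne_eq_zero {z : cyclesOne x y M} :
    Submodule.mkQ (LinearMap.range (toCyclesOne x y M)) z = 0 ↔
      ∃ c, y • c = z.1.1 ∧ -(x • c) = z.1.2 := by
  rw [Submodule.mkQ_apply, Submodule.Quotient.mk_eq_zero]
  constructor
  · rintro ⟨c, rfl⟩
    exact ⟨c, rfl, rfl⟩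
  · rintro ⟨c, h₁, h₂⟩
    exact ⟨c, Subtype.ext (Prod.ext h₁ h₂)⟩

/-- Interchanging the two elements does not change the first Koszul homology. -/
def hOneSwap : hOne x y M ≃ₗ[R] hOne y x M :=
  Submodule.Quotient.equiv _ _
    ((LinearEquiv.prodComm R M M).ofSubmodules (cyclesOne x y M) (cyclesOne y x M) (by
      ext ⟨a, b⟩
      rw [Submodule.mem_map_equiv]
      simp [add_comm])) (by
    ext ⟨⟨a, b⟩, h⟩
    constructor
    · rintro ⟨_, ⟨c, rfl⟩, h⟩
      refine ⟨-c, ?_⟩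
      rw [← h]
      ext <;> simp [toCyclesOne]
    · rintro ⟨c, h⟩
      refine ⟨_, ⟨-c, rfl⟩, ?_⟩
      rw [← h]
      ext <;> simp [toCyclesOne])

/-- The inclusion of `(0 : x) / y (0 : x)` into the first Koszul homology. -/
def toHOne : (LinearMap.ker (LinearMap.lsmul R M x) ⧸
    LinearMap.range (LinearMap.lsmul R (LinearMap.ker (LinearMap.lsmul R M x)) y)) →ₗ[R]
      hOne x y M :=
  Submodule.mapQ _ _
    (((LinearMap.inl R M M).comp (LinearMap.ker (LinearMap.lsmul R M x)).subtype).codRestrict _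
      (fun a => by simp)) (by
    rintro _ ⟨a, rfl⟩
    exact ⟨a.1, Subtype.ext (Prod.ext rfl (neg_eq_zero.2 a.2))⟩)

/-- The projection of the first Koszul homology to `0 :_{M / x M} y`. -/
def ofHOne : hOne x y M →ₗ[R]
    LinearMap.ker (LinearMap.lsmul R (M ⧸ LinearMap.range (LinearMap.lsmul R M x)) y) :=
  Submodule.liftQ _
    ((((LinearMap.range (LinearMap.lsmul R M x)).mkQ.comp (LinearMap.snd R M M)).comp
      (cyclesOne x y M).subtype).codRestrict _ (by
        rintro ⟨⟨a, b⟩, h⟩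
        simp only [LinearMap.mem_ker, LinearMap.coprod_apply, LinearMap.lsmul_apply] at h
        rw [LinearMap.mem_ker, LinearMap.lsmul_apply, ← map_smul]
        refine (Submodule.Quotient.mk_eq_zero _).2 ?_
        exact ⟨-a, by
          simpa [neg_eq_iff_add_eq_zero] using h⟩)) (by
    rintro _ ⟨c, rfl⟩
    refine Subtype.ext ((Submodule.Quotient.mk_eq_zero _).2 ⟨-c, ?_⟩)
    simp [toCyclesOne])

lemma toHOne_injective : Function.Injective (toHOne x y M) := by
  rw [← LinearMap.ker_eq_bot, Submodule.eq_bot_iff]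
  intro a ha
  obtain ⟨a, rfl⟩ := Submodule.mkQ_surjective _ a
  obtain ⟨c, h₁, h₂⟩ := (mk_hOne_eq_zero x y M).1 (LinearMap.mem_ker.1 ha)
  exact (Submodule.Quotient.mk_eq_zero _).2 ⟨⟨c, neg_eq_zero.1 h₂⟩, Subtype.ext h₁⟩

lemma ofHOne_surjective : Function.Surjective (ofHOne x y M) := by
  rintro ⟨b, hb⟩
  obtain ⟨b, rfl⟩ := Submodule.mkQ_surjective _ b
  rw [LinearMap.mem_ker, LinearMap.lsmul_apply, ← map_smul, Submodule.mkQ_apply,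
    Submodule.Quotient.mk_eq_zero] at hb
  obtain ⟨a, ha⟩ := hb
  refine ⟨Submodule.mkQ _ ⟨(-a, b), ?_⟩, rfl⟩
  rw [LinearMap.lsmul_apply] at ha
  simp [ha]

lemma exact_toHOne_ofHOne : Function.Exact (toHOne x y M) (ofHOne x y M) := by
  intro t
  constructor
  · intro h
    obtain ⟨⟨⟨a, b⟩, hab⟩, rfl⟩ := Submodule.mkQ_surjective _ t
    obtain ⟨c, hc⟩ := (Submodule.Quotient.mk_eq_zero _).1 (congrArg Subtype.val h)
    simp only [LinearMap.mem_ker, LinearMap.coprod_apply, LinearMap.lsmul_apply] at hab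
    replace hc : x • c = b := hc
    refine ⟨Submodule.mkQ _ ⟨a + y • c, ?_⟩, ?_⟩
    · rw [LinearMap.mem_ker, LinearMap.lsmul_apply, smul_add, smul_smul, mul_comm, mul_smul, hc,
        hab]
    · refine (Submodule.Quotient.eq _).2 ⟨c, Subtype.ext (Prod.ext ?_ ?_)⟩
      · exact (add_sub_cancel_left a (y • c)).symm
      · exact (congrArg Neg.neg hc).trans (zero_sub b).symm
  · rintro ⟨a, rfl⟩
    obtain ⟨a, rfl⟩ := Submodule.mkQ_surjective _ a
    exact Subtype.ext ((Submodule.Quotient.mk_eq_zero _).2 (zero_mem _))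

/-- `(M / x) / y ≅ (M / y) / x`. -/
noncomputable def quotientLsmulSwap :
    ((M ⧸ LinearMap.range (LinearMap.lsmul R M x)) ⧸
      LinearMap.range (LinearMap.lsmul R (M ⧸ LinearMap.range (LinearMap.lsmul R M x)) y)) ≃ₗ[R]
    ((M ⧸ LinearMap.range (LinearMap.lsmul R M y)) ⧸
      LinearMap.range (LinearMap.lsmul R (M ⧸ LinearMap.range (LinearMap.lsmul R M y)) x)) := by
  have key : ∀ x y : R, LinearMap.ker ((Submodule.mkQ (LinearMap.range
      (LinearMap.lsmul R (M ⧸ LinearMap.range (LinearMap.lsmul R M x)) y))).comp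
        (Submodule.mkQ (LinearMap.range (LinearMap.lsmul R M x)))) =
      LinearMap.range (LinearMap.lsmul R M x) ⊔ LinearMap.range (LinearMap.lsmul R M y) := by
    intro x y
    ext m
    rw [LinearMap.mem_ker, LinearMap.comp_apply, Submodule.mkQ_apply,
      Submodule.Quotient.mk_eq_zero, Submodule.mem_sup]
    constructor
    · rintro ⟨c, hc⟩
      obtain ⟨c, rfl⟩ := Submodule.mkQ_surjective _ c
      rw [LinearMap.lsmul_apply, ← map_smul] at hc
      obtain ⟨d, hd⟩ := (Submodule.Quotient.eq _).1 hc.symm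
      exact ⟨_, ⟨d, hd⟩, _, ⟨c, rfl⟩, by simp⟩
    · rintro ⟨_, ⟨d, rfl⟩, _, ⟨c, rfl⟩, rfl⟩
      refine ⟨Submodule.mkQ _ c, ?_⟩
      rw [LinearMap.lsmul_apply, ← map_smul]
      exact (Submodule.Quotient.eq _).2 ⟨-d, by simp⟩
  have hs : ∀ x y : R, Function.Surjective ((Submodule.mkQ (LinearMap.range
      (LinearMap.lsmul R (M ⧸ LinearMap.range (LinearMap.lsmul R M x)) y))).comp
        (Submodule.mkQ (LinearMap.range (LinearMap.lsmul R M x)))) := fun x y =>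
    (Submodule.mkQ_surjective _).comp (Submodule.mkQ_surjective _)
  exact (LinearMap.quotKerEquivOfSurjective _ (hs x y)).symm.trans
    ((Submodule.quotEquivOfEq _ _ ((key x y).trans ((sup_comm _ _).trans (key y x).symm))).trans
      (LinearMap.quotKerEquivOfSurjective _ (hs y x)))

/-- `0 :_{0 : x} y ≅ 0 :_{0 : y} x`. -/
def kerLsmulSwap :
    LinearMap.ker (LinearMap.lsmul R (LinearMap.ker (LinearMap.lsmul R M x)) y) ≃ₗ[R]
    LinearMap.ker (LinearMap.lsmul R (LinearMap.ker (LinearMap.lsmul R M y)) x) where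
  toFun m := ⟨⟨m.1.1, congrArg Subtype.val m.2⟩, Subtype.ext m.1.2⟩
  invFun m := ⟨⟨m.1.1, congrArg Subtype.val m.2⟩, Subtype.ext m.1.2⟩
  map_add' _ _ := rfl
  map_smul' _ _ := rfl
  left_inv _ := rfl
  right_inv _ := rfl

end HOne

variable [IsLocalRing R] [IsNoetherianRing R] {M : Type v} [AddCommGroup M] [Module R M]

/-- Unfolding twice gives four terms. The terms of (M/x)/y and of 0 :_{0:x} y are symmetric in x and
y. The other two, of (0 : x)/y(0 : x) and of 0 :_{M/x} y, are the ends of a short exact sequence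
with middle term H₁(x, y; M), so their sum is symmetric as well. -/
lemma mult_swap (x y : R) (zs : List R) (h : IsParam (x :: y :: zs) M) :
    mult (x :: y :: zs) M = mult (y :: x :: zs) M := by
  have h' : IsParam (y :: x :: zs) M := h.perm (List.Perm.swap _ _ _)
  have hT : ∀ x y : R, IsParam (x :: y :: zs) M → IsParam zs (hOne x y M) := fun x y h =>
    IsParam.of_exact h.ker.quotient h.quotient.ker (toHOne x y M) (ofHOne x y M)
      (ofHOne_surjective x y M) (exact_toHOne_ofHOne x y M)
  have key : ∀ x y : R, IsParam (x :: y :: zs) M → mult zs (hOne x y M) = _ := fun x y h =>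
    mult_eq_add (toHOne x y M) (ofHOne x y M) (hT x y h) (toHOne_injective x y M)
      (ofHOne_surjective x y M) (exact_toHOne_ofHOne x y M)
  have e₁ := mult_congr (hOneSwap x y M) (hT y x h')
  rw [key x y h, key y x h'] at e₁
  have e₂ := mult_congr (quotientLsmulSwap x y M) h'.quotient.quotient
  have e₃ := mult_congr (kerLsmulSwap x y M) h'.ker.ker
  simp only [mult]
  rw [e₂, e₃]
  linarith

theorem mult_perm {xs ys : List R} (hp : xs.Perm ys) (h : IsParam xs M) :
    mult xs M = mult ys M := by
  induction hp generalizing M with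
  | nil => rfl
  | cons x _ ih => simp only [mult]; rw [ih h.quotient, ih h.ker]
  | swap x y l => exact mult_swap _ _ _ h
  | trans h₁ _ ih₁ ih₂ => exact (ih₁ h).trans (ih₂ (h.perm h₁))

omit [IsLocalRing R] [IsNoetherianRing R] in
-- The last entry acts only on modules already killed by all of zs and by ann M, so only its class
-- matters.
lemma mult_append_singleton_congr {zs : List R} {a b : R}
    (h : a - b ∈ Ideal.ofList zs ⊔ Module.annihilator R M) :
    mult (zs ++ [a]) M = mult (zs ++ [b]) M := by
  induction zs generalizing M with
  | nil =>
    have : LinearMap.lsmul R M a = LinearMap.lsmul R M b := by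
      ext m
      have := Module.mem_annihilator.1 (by simpa using h) m
      rwa [sub_smul, sub_eq_zero] at this
    simp only [List.nil_append, mult]
    rw [this]
  | cons w ws ih =>
    have key : ∀ {N : Type v} [AddCommGroup N] [Module R N], w ∈ Module.annihilator R N →
        Module.annihilator R M ≤ Module.annihilator R N →
        a - b ∈ Ideal.ofList ws ⊔ Module.annihilator R N := by
      intro N _ _ h₁ h₂
      refine (?_ : Ideal.ofList (w :: ws) ⊔ Module.annihilator R M ≤ _) h
      rw [Ideal.ofList_cons]
      exact sup_le (sup_le ((Ideal.span_singleton_le_iff_mem _).2 (Ideal.mem_sup_right h₁))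
        le_sup_left) (h₂.trans le_sup_right)
    simp only [List.cons_append, mult]
    rw [ih (key (mem_annihilator_quotient_lsmul w)
        (LinearMap.annihilator_le_of_surjective _ (Submodule.mkQ_surjective _))),
      ih (key (mem_annihilator_ker_lsmul w)
        (LinearMap.annihilator_le_of_injective _ (Submodule.subtype_injective _)))]

lemma mult_cons_congr {zs : List R} {a b : R} (ha : IsParam (a :: zs) M)
    (h : a - b ∈ Ideal.ofList zs ⊔ Module.annihilator R M) :
    mult (a :: zs) M = mult (b :: zs) M := by
  have hp : ∀ c : R, (c :: zs).Perm (zs ++ [c]) := fun c =>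
    (List.perm_append_singleton c zs).symm
  have hb : IsParam (b :: zs) M := by
    refine ha.mono ?_
    rw [Ideal.ofList_cons, Ideal.ofList_cons]
    refine sup_le ((Ideal.span_singleton_le_iff_mem _).2 ?_) (le_sup_right.trans le_sup_left)
    rw [← sub_add_cancel a b]
    refine add_mem (sup_le_sup_right (le_sup_right : _ ≤ Ideal.span {b} ⊔ Ideal.ofList zs) _ h)
      (Ideal.mem_sup_left (Ideal.mem_sup_left (Ideal.mem_span_singleton_self b)))
  rw [mult_perm (hp a) ha, mult_perm (hp b) hb, mult_append_singleton_congr h]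

open LinearMap in
-- Uses the exact sequence 0 → (0 : a) → (0 : ab) → (0 : b) → M/aM → M/abM → M/bM → 0, where the
-- second map is multiplication by a and the fourth is multiplication by b.
lemma mult_mul_cons {zs : List R} {a b : R} (h : IsParam (a * b :: zs) M) :
    mult (a * b :: zs) M = mult (a :: zs) M + mult (b :: zs) M := by
  have hle : ∀ c : R, c ∣ a * b → IsParam (c :: zs) M := fun c hc => by
    refine h.mono (le_trans ?_ le_sup_left)
    rw [Ideal.ofList_cons, Ideal.ofList_cons]
    exact sup_le_sup_right (Ideal.span_singleton_le_span_singleton.2 hc) _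
  have ha := hle a (dvd_mul_right a b)
  have hb := hle b (dvd_mul_left b a)
  simp only [mult]
  let F₁ : ker (lsmul R M a) →ₗ[R] ker (lsmul R M (a * b)) :=
    Submodule.inclusion (fun m hm => by
      rw [mem_ker_lsmul] at *
      rw [mul_comm, mul_smul, hm, smul_zero])
  let F₂ : ker (lsmul R M (a * b)) →ₗ[R] ker (lsmul R M b) :=
    (lsmul R M a).restrict (fun m hm => by
      rw [mem_ker_lsmul] at *
      rw [lsmul_apply, smul_smul, mul_comm, hm])
  let δ : ker (lsmul R M b) →ₗ[R] M ⧸ range (lsmul R M a) :=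
    (Submodule.mkQ _).comp (ker (lsmul R M b)).subtype
  let G₁ : (M ⧸ range (lsmul R M a)) →ₗ[R] M ⧸ range (lsmul R M (a * b)) :=
    Submodule.mapQ _ _ (lsmul R M b) (by
      rintro _ ⟨m, rfl⟩
      exact ⟨m, by simp [smul_smul]⟩)
  let G₂ : (M ⧸ range (lsmul R M (a * b))) →ₗ[R] M ⧸ range (lsmul R M b) :=
    Submodule.factor (by
      rintro _ ⟨m, rfl⟩
      exact ⟨a • m, by simp [smul_smul]⟩)
  refine MultAdditive.mult_exact_six (multAdditive zs) F₁ F₂ δ G₁ G₂ ha.ker h.ker hb.ker ha.quotient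
    h.quotient hb.quotient ?_ ?_ ?_ ?_ ?_ ?_
  · exact Submodule.inclusion_injective _
  · rintro ⟨m, hm⟩
    constructor
    · intro h
      exact ⟨⟨m, congrArg Subtype.val h⟩, rfl⟩
    · rintro ⟨⟨n, hn⟩, h⟩
      rw [← h]
      exact Subtype.ext hn
  · rintro ⟨m, hm⟩
    constructor
    · intro h
      obtain ⟨n, hn⟩ := (Submodule.Quotient.mk_eq_zero _).1 h
      replace hn : a • n = m := hn
      refine ⟨⟨n, ?_⟩, Subtype.ext hn⟩
      rw [mem_ker_lsmul] at *
      rw [mul_comm, mul_smul, hn, hm]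
    · rintro ⟨⟨n, hn⟩, h⟩
      rw [← h]
      exact (Submodule.Quotient.mk_eq_zero _).2 ⟨n, rfl⟩
  · intro m
    obtain ⟨m, rfl⟩ := Submodule.mkQ_surjective _ m
    constructor
    · intro h
      obtain ⟨n, hn⟩ := (Submodule.Quotient.mk_eq_zero _).1 h
      replace hn : (a * b) • n = b • m := hn
      refine ⟨⟨m - a • n, ?_⟩, ?_⟩
      · rw [mem_ker_lsmul, smul_sub, smul_smul, mul_comm b a, hn, sub_self]
      · exact (Submodule.Quotient.eq _).2 ⟨-n, by simp⟩
    · rintro ⟨⟨n, hn⟩, h⟩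
      rw [← h]
      refine (Submodule.Quotient.mk_eq_zero _).2 ?_
      rw [mem_ker_lsmul] at hn
      simp [hn]
  · intro m
    obtain ⟨m, rfl⟩ := Submodule.mkQ_surjective _ m
    constructor
    · intro h
      obtain ⟨n, hn⟩ := (Submodule.Quotient.mk_eq_zero _).1 h
      exact ⟨Submodule.mkQ _ n, congrArg _ hn⟩
    · rintro ⟨n, h⟩
      obtain ⟨n, rfl⟩ := Submodule.mkQ_surjective _ n
      rw [← h]
      exact (Submodule.Quotient.mk_eq_zero _).2 ⟨n, rfl⟩
  · exact Submodule.factor_surjective _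

end Permutation

/-! ### Existence of superficial elements. -/

section Superficial

open scoped Pointwise in
/-- Avoidance of finitely many ideals over a local ring with infinite residue field. -/
lemma exists_mem_forall_notMem {R : Type u} [CommRing R] [IsLocalRing R]
    [Infinite (ResidueField R)] {I : Ideal R} (hI : I.FG) {𝒲 : Set (Ideal R)}
    (hfin : 𝒲.Finite) (h𝒲 : ∀ W ∈ 𝒲, ¬ I ≤ W) : ∃ z ∈ I, ∀ W ∈ 𝒲, z ∉ W := by
  by_contra! hcon
  let H : Ideal R → AddSubgroup I := fun W => (Submodule.comap (Submodule.subtype I) W).toAddSubgroup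
  have hcov : ⋃ W ∈ hfin.toFinset, ((0 : I) +ᵥ (H W : Set I)) = Set.univ := by
    refine Set.eq_univ_of_forall fun z => ?_
    obtain ⟨W, hW, hz⟩ := hcon z z.2
    simp only [zero_vadd, Set.mem_iUnion]
    exact ⟨W, by simpa using hW, hz⟩
  -- By B. H. Neumann's lemma, in a finite cover by cosets some subgroup has finite index; a line of
  -- residue-field multiples of one element will contradict this.
  obtain ⟨W, hW, hidx⟩ := AddSubgroup.exists_finiteIndex_of_leftCoset_cover (g := fun _ => 0) hcov
  rw [Set.Finite.mem_toFinset] at hW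
  -- Adding 𝔪I makes membership of r • v depend only on the residue of r, and Nakayama keeps the
  -- ideal from containing I.
  let W' : Ideal R := (W ⊓ I) ⊔ maximalIdeal R • I
  have hW' : ¬ I ≤ W' := fun h => h𝒲 W hW <| by
    refine le_trans ?_ (inf_le_left : W ⊓ I ≤ W)
    exact Submodule.le_of_le_smul_of_le_jacobson_bot hI (IsLocalRing.maximalIdeal_le_jacobson _) h
  obtain ⟨v, hvI, hv⟩ := Set.not_subset.1 hW'
  have hcol : ∀ r : R, r • v ∈ W' → r ∈ maximalIdeal R := by
    intro r hr
    by_contra hu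
    rw [IsLocalRing.notMem_maximalIdeal] at hu
    exact hv ((Submodule.smul_mem_iff_of_isUnit _ hu).1 hr)
  have : Finite (I ⧸ H W) := AddSubgroup.finite_quotient_of_finiteIndex
  let φ : ResidueField R → I ⧸ H W := fun a =>
    QuotientAddGroup.mk ⟨Function.surjInv IsLocalRing.residue_surjective a • v, I.smul_mem _ hvI⟩
  refine not_injective_infinite_finite φ fun a b hab => ?_
  have h₁ := QuotientAddGroup.eq.1 hab
  rw [← Function.surjInv_eq IsLocalRing.residue_surjective a,
    ← Function.surjInv_eq IsLocalRing.residue_surjective b, ← sub_eq_zero, ← map_sub,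
    IsLocalRing.residue_eq_zero_iff]
  refine hcol _ (Ideal.mem_sup_left ⟨?_, I.smul_mem _ hvI⟩)
  have h₂ : -(Function.surjInv IsLocalRing.residue_surjective a • v) +
    Function.surjInv IsLocalRing.residue_surjective b • v ∈ W := h₁
  rw [sub_smul]
  simpa [sub_eq_add_neg, add_comm] using W.neg_mem h₂

/-- Associated primes of K = (0 :_Q s) are associated primes of Q containing s, hence contain 𝔞, so
𝔞^c K = 0 for some c. By Artin–Rees, 𝔞^(c+k) Q ∩ K ⊆ 𝔞^c K = 0. -/
lemma exists_pow_smul_eq_zero_imp {S : Type u} [CommRing S] [IsNoetherianRing S] {Q : Type v}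
    [AddCommGroup Q] [Module S Q] [Module.Finite S Q] (𝔞 : Ideal S) (s : S)
    (hs : ∀ p ∈ associatedPrimes S Q, s ∈ p → 𝔞 ≤ p) :
    ∃ n, ∀ q ∈ (𝔞 ^ n • ⊤ : Submodule S Q), s • q = 0 → q = 0 := by
  let K := LinearMap.ker (LinearMap.lsmul S Q s)
  have hrad : 𝔞 ≤ (Module.annihilator S K).radical := by
    rw [← Ideal.sInf_minimalPrimes]
    refine le_sInf fun p hp => hs p ?_ ?_
    · exact associatedPrimes.subset_of_injective (Submodule.subtype_injective K)
        (Module.associatedPrimes.minimalPrimes_annihilator_subset_associatedPrimes S K hp)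
    · exact hp.1.2 (mem_annihilator_ker_lsmul s)
  obtain ⟨c, hc⟩ := Ideal.exists_pow_le_of_le_radical_of_fg hrad (IsNoetherian.noetherian _)
  obtain ⟨k, hk⟩ := 𝔞.exists_pow_inf_eq_pow_smul K
  refine ⟨c + k, fun q hq hsq => ?_⟩
  have h : q ∈ 𝔞 ^ (c + k) • ⊤ ⊓ K := ⟨hq, hsq⟩
  rw [hk _ (by omega), Nat.add_sub_cancel] at h
  have h' : q ∈ Module.annihilator S K • K := Submodule.smul_mono hc inf_le_right h
  have : Module.annihilator S K = Submodule.annihilator K := rfl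
  rw [this, Submodule.annihilator_smul] at h'
  simpa using h'

variable {R : Type u} [CommRing R] [IsNoetherianRing R] (I : Ideal R)
  (M : Type v) [AddCommGroup M] [Module R M]

/-- The degree one inclusion of an ideal into its Rees algebra. -/
noncomputable def toRees : I →ₗ[R] reesAlgebra I where
  toFun z := ⟨Polynomial.monomial 1 z.1, reesAlgebra.monomial_mem.2 (by simp)⟩
  map_add' _ _ := Subtype.ext (by simp)
  map_smul' _ _ := Subtype.ext (by simp [Polynomial.smul_monomial])

omit [IsNoetherianRing R] in
lemma toRees_smul_single (z : I) (j : ℕ) (u : M) :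
    toRees I z • PolynomialModule.single R j u = PolynomialModule.single R (j + 1) (z.1 • u) := by
  rw [add_comm]
  exact PolynomialModule.monomial_smul_single 1 z.1 j u

omit [IsNoetherianRing R] in
-- The Rees module ⊕ I^j M is generated in degree zero, so its elements of high degree are divisible
-- by high powers of the ideal spanned by the degree-one part.
lemma single_mem_pow_smul (n j : ℕ) (hnj : n ≤ j) (u : M) (hu : u ∈ (I ^ j • ⊤ : Submodule R M)) :
    PolynomialModule.single R j u ∈
      (Ideal.span (Set.range (toRees I))) ^ n • (I.stableFiltration (⊤ : Submodule R M)).submodule := by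
  induction n generalizing j u with
  | zero =>
    rw [pow_zero, Ideal.one_eq_top, Submodule.top_smul]
    intro i
    rw [PolynomialModule.coeff_single, Finsupp.single_apply]
    split_ifs with h
    · rwa [← h]
    · exact zero_mem _
  | succ n ih =>
    obtain ⟨j, rfl⟩ : ∃ i, j = i + 1 := ⟨j - 1, by omega⟩
    rw [pow_succ', mul_smul] at hu
    rw [pow_succ', Submodule.mul_smul]
    refine Submodule.smul_induction_on hu (fun r hr m hm => ?_) (fun x y hx hy => ?_)
    · rw [← toRees_smul_single I M ⟨r, hr⟩]
      exact Submodule.smul_mem_smul (Ideal.subset_span ⟨_, rfl⟩) (ih j (by omega) m hm)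
    · rw [PolynomialModule.single_add]
      exact add_mem hx hy

/-- Existence of superficial elements, avoiding finitely many prescribed ideals. -/
theorem exists_superficial [IsLocalRing R] [Infinite (ResidueField R)] [Module.Finite R M]
    {𝒲 : Set (Ideal R)} (hfin : 𝒲.Finite) (h𝒲 : ∀ W ∈ 𝒲, ¬ I ≤ W) :
    ∃ z ∈ I, (∀ W ∈ 𝒲, z ∉ W) ∧ ∃ c, ∀ j ≥ c, ∀ u ∈ (I ^ j • ⊤ : Submodule R M),
      z • u ∈ (I ^ (j + 2) • ⊤ : Submodule R M) → u ∈ (I ^ (j + 1) • ⊤ : Submodule R M) := by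
  let S := reesAlgebra I
  let 𝔞 : Ideal S := Ideal.span (Set.range (toRees I))
  let F := (I.stableFiltration (⊤ : Submodule R M)).submodule
  let F' := (I.stableFiltration (I • ⊤ : Submodule R M)).submodule
  -- N is the associated graded module ⊕ I^j M / I^(j+1) M, realized over the Rees algebra.
  let N := F.map F'.mkQ
  have hFG : F.FG := (Ideal.Filtration.submodule_fg_iff_stable _
    (fun i => IsNoetherian.noetherian _)).2 (I.stableFiltration_stable ⊤)
  have hNfin : Module.Finite S N := Module.Finite.iff_fg.2 (hFG.map _)
  have hass : (associatedPrimes S N).Finite := associatedPrimes.finite S N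
  -- V p is the trace of p on degree one, read as an ideal of R. Avoiding it for the associated
  -- primes p of N not containing 𝔞 keeps the degree-one form of z out of all of them.
  let V : Ideal S → Ideal R := fun p =>
    ((p.restrictScalars R).comap (toRees I)).map I.subtype
  have hV : ∀ (p : Ideal S) (z : I), z.1 ∈ V p → toRees I z ∈ p := by
    rintro p z ⟨z', hz', h⟩
    obtain rfl : z' = z := Subtype.ext h
    exact hz'
  obtain ⟨z, hzI, hz⟩ := exists_mem_forall_notMem (I := I) (IsNoetherian.noetherian I)
    (𝒲 := 𝒲 ∪ V '' {p ∈ associatedPrimes S N | ¬ 𝔞 ≤ p})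
    (hfin.union ((hass.subset (Set.sep_subset _ _)).image _)) (by
      rintro W (hW | ⟨p, ⟨-, hp⟩, rfl⟩)
      · exact h𝒲 W hW
      · refine fun hle => hp (Ideal.span_le.2 ?_)
        rintro _ ⟨z, rfl⟩
        exact hV p z (hle z.2))
  refine ⟨z, hzI, fun W hW => hz W (.inl hW), ?_⟩
  obtain ⟨n, hn⟩ := exists_pow_smul_eq_zero_imp (Q := N) 𝔞 (toRees I ⟨z, hzI⟩) (by
    intro p hp hzp
    by_contra hle
    exact hz _ (.inr ⟨p, ⟨hp, hle⟩, rfl⟩) ⟨⟨z, hzI⟩, hzp, rfl⟩)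
  refine ⟨n, fun j hj u hu hzu => ?_⟩
  have hmem : F'.mkQ (PolynomialModule.single R j u) ∈ 𝔞 ^ n • N := by
    rw [← Submodule.map_smul'']
    exact Submodule.mem_map_of_mem (single_mem_pow_smul I M n j hj u hu)
  have h := hn ⟨_, Submodule.smul_le_right hmem⟩ ((Submodule.mem_smul_top_iff _ _ _).2 hmem) (by
    refine Subtype.ext ?_
    change toRees I ⟨z, hzI⟩ • F'.mkQ _ = 0
    rw [← map_smul, toRees_smul_single, Submodule.mkQ_apply, Submodule.Quotient.mk_eq_zero]
    intro i
    rw [PolynomialModule.coeff_single, Finsupp.single_apply]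
    split_ifs with h
    · subst h
      change _ ∈ I ^ (j + 1) • (I • ⊤ : Submodule R M)
      rwa [← mul_smul, ← pow_succ]
    · exact zero_mem _)
  replace h := (Submodule.Quotient.mk_eq_zero _).1 (congrArg Subtype.val h) j
  rw [PolynomialModule.coeff_single, Finsupp.single_apply, if_pos rfl] at h
  change _ ∈ I ^ j • (I • ⊤ : Submodule R M) at h
  rwa [← mul_smul, ← pow_succ] at h

end Superficial

/-! ### Hilbert–Samuel functions and superficial elements. -/

section HilbertFunction

lemma length_add_eq_of_exact_four {R : Type u} [CommRing R] {A B C D : Type v} [AddCommGroup A]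
    [AddCommGroup B] [AddCommGroup C] [AddCommGroup D] [Module R A] [Module R B] [Module R C]
    [Module R D] (f : A →ₗ[R] B) (g : B →ₗ[R] C) (h : C →ₗ[R] D) (hf : Function.Injective f)
    (hfg : Function.Exact f g) (hgh : Function.Exact g h) (hh : Function.Surjective h) :
    Module.length R A + Module.length R C = Module.length R B + Module.length R D := by
  rw [Module.length_eq_add_of_exact f g.rangeRestrict hf g.surjective_rangeRestrict
      (by rw [LinearMap.exact_iff] at *; rw [LinearMap.ker_rangeRestrict, hfg]),
    Module.length_eq_add_of_exact (LinearMap.range g).subtype h (Submodule.subtype_injective _) hh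
      (by rw [LinearMap.exact_iff] at *; rw [Submodule.range_subtype, hgh]), add_assoc]

variable {R : Type u} [CommRing R]

/-- The Hilbert--Samuel function `k ↦ ℓ(M / I^k M)`. -/
noncomputable def hilbertFn (I : Ideal R) (M : Type v) [AddCommGroup M] [Module R M] (k : ℕ) : ℕ :=
  (Module.length R (M ⧸ (I ^ k • ⊤ : Submodule R M))).toNat

/-- `z` is superficial for `M` with respect to `I` from degree `c` on. -/
def IsSuperficial (I : Ideal R) (M : Type v) [AddCommGroup M] [Module R M] (z : R) (c : ℕ) :
    Prop :=
  ∀ j ≥ c, ∀ u ∈ (I ^ j • ⊤ : Submodule R M),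
    z • u ∈ (I ^ (j + 2) • ⊤ : Submodule R M) → u ∈ (I ^ (j + 1) • ⊤ : Submodule R M)

variable {I : Ideal R} {M : Type v} [AddCommGroup M] [Module R M]

lemma pow_smul_top_antitone (I : Ideal R) (M : Type v) [AddCommGroup M] [Module R M] :
    Antitone fun k => (I ^ k • ⊤ : Submodule R M) :=
  fun _ _ h => Submodule.smul_mono_left (Ideal.pow_le_pow_right h)

namespace IsSuperficial

variable {z : R} {c : ℕ}

lemma mem_pow_smul (h : IsSuperficial I M z c) {k : ℕ} (hk : c ≤ k) {u : M}
    (hu : u ∈ (I ^ c • ⊤ : Submodule R M)) (hzu : z • u ∈ (I ^ (k + 1) • ⊤ : Submodule R M)) :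
    u ∈ (I ^ k • ⊤ : Submodule R M) := by
  induction k, hk using Nat.le_induction with
  | base => exact hu
  | succ k hk ih => exact h k hk u (ih (pow_smul_top_antitone I M (by omega) hzu)) hzu

variable [IsNoetherianRing R] [IsLocalRing R] [Module.Finite R M]

/-- A kernel element in I^c M climbs through the filtration indefinitely, because 0 lies in every
step; Krull's intersection theorem ends the argument. -/
lemma ker_inf_eq_bot (h : IsSuperficial I M z c) (hI : I ≠ ⊤) {k : ℕ} (hk : c ≤ k) :
    LinearMap.ker (LinearMap.lsmul R M z) ⊓ (I ^ k • ⊤ : Submodule R M) = ⊥ := by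
  rw [eq_bot_iff, ← I.iInf_pow_smul_eq_bot_of_isLocalRing hI]
  refine le_iInf fun n u hu => ?_
  refine pow_smul_top_antitone I M (le_max_left n c) (h.mem_pow_smul (le_max_right n c)
    (pow_smul_top_antitone I M hk hu.2) ?_)
  rw [mem_ker_lsmul.1 hu.1]
  exact zero_mem _

omit [IsLocalRing R] in
-- By Artin–Rees for zM, the product zu equals zw with w in I^(k+1-c') M. For k ≥ c + c' this is
-- deep enough for superficiality to push w up to I^k M.
lemma exists_smul_eq (h : IsSuperficial I M z c) :
    ∃ k₀ ≥ c, ∀ k ≥ k₀, ∀ u : M, z • u ∈ (I ^ (k + 1) • ⊤ : Submodule R M) →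
      ∃ w ∈ (I ^ k • ⊤ : Submodule R M), z • u = z • w := by
  obtain ⟨c', hc'⟩ := I.exists_pow_inf_eq_pow_smul (LinearMap.range (LinearMap.lsmul R M z))
  refine ⟨c + c', by omega, fun k hk u hu => ?_⟩
  have hmem : z • u ∈ I ^ (k + 1) • ⊤ ⊓ LinearMap.range (LinearMap.lsmul R M z) := ⟨hu, u, rfl⟩
  rw [hc' _ (by omega)] at hmem
  have h₂ : z • u ∈ (I ^ (k + 1 - c') • ⊤ : Submodule R M).map (LinearMap.lsmul R M z) := by
    rw [Submodule.map_smul'', Submodule.map_top]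
    exact Submodule.smul_mono le_rfl inf_le_right hmem
  obtain ⟨w, hw, hzw⟩ := h₂
  replace hzw : z • w = z • u := hzw
  refine ⟨w, h.mem_pow_smul (by omega) (pow_smul_top_antitone I M (by omega) hw) ?_, hzw.symm⟩
  rwa [hzw]

/-- For large k the sequence 0 → (0 : z) → M/I^k M → M/I^(k+1) M → (M/zM)/I^(k+1)(M/zM) → 0, with
middle map multiplication by z, is exact. -/
lemma exists_length_eq (h : IsSuperficial I M z c) (hz : z ∈ I) (hI : I ≠ ⊤) :
    ∃ k₀, ∀ k ≥ k₀,
      Module.length R (LinearMap.ker (LinearMap.lsmul R M z)) +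
        Module.length R (M ⧸ (I ^ (k + 1) • ⊤ : Submodule R M)) =
      Module.length R (M ⧸ (I ^ k • ⊤ : Submodule R M)) +
        Module.length R ((M ⧸ LinearMap.range (LinearMap.lsmul R M z)) ⧸
          (I ^ (k + 1) • ⊤ : Submodule R (M ⧸ LinearMap.range (LinearMap.lsmul R M z)))) := by
  obtain ⟨k₀, hk₀, H⟩ := h.exists_smul_eq
  refine ⟨k₀, fun k hk => ?_⟩
  let K := LinearMap.ker (LinearMap.lsmul R M z)
  let Z := LinearMap.range (LinearMap.lsmul R M z)
  have hzI : (I ^ k • ⊤ : Submodule R M) ≤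
      (I ^ (k + 1) • ⊤ : Submodule R M).comap (LinearMap.lsmul R M z) := by
    intro u hu
    rw [Submodule.mem_comap, LinearMap.lsmul_apply, pow_succ', Submodule.mul_smul]
    exact Submodule.smul_mem_smul hz hu
  have hZ : (I ^ (k + 1) • ⊤ : Submodule R (M ⧸ Z)) = (I ^ (k + 1) • ⊤ : Submodule R M).map Z.mkQ := by
    rw [Submodule.map_smul'', Submodule.map_top, Submodule.range_mkQ]
  refine length_add_eq_of_exact_four
    ((I ^ k • ⊤ : Submodule R M).mkQ.comp K.subtype)
    (Submodule.mapQ _ _ (LinearMap.lsmul R M z) hzI)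
    (Submodule.mapQ _ _ Z.mkQ (by rw [hZ]; exact Submodule.le_comap_map _ _)) ?_ ?_ ?_ ?_
  · rw [← LinearMap.ker_eq_bot, Submodule.eq_bot_iff]
    rintro ⟨u, hu⟩ h'
    have hmem := (Submodule.Quotient.mk_eq_zero _).1 (LinearMap.mem_ker.1 h')
    have : u ∈ K ⊓ (I ^ k • ⊤ : Submodule R M) := ⟨hu, hmem⟩
    rw [h.ker_inf_eq_bot hI (hk₀.trans hk)] at this
    exact Subtype.ext this
  · intro u
    obtain ⟨u, rfl⟩ := Submodule.mkQ_surjective _ u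
    constructor
    · intro hu
      obtain ⟨w, hw, hzw⟩ := H k hk u ((Submodule.Quotient.mk_eq_zero _).1 hu)
      refine ⟨⟨u - w, ?_⟩, (Submodule.Quotient.eq _).2 ?_⟩
      · rw [mem_ker_lsmul, smul_sub, hzw, sub_self]
      · simpa using hw
    · rintro ⟨⟨n, hn⟩, hu⟩
      rw [← hu]
      refine (Submodule.Quotient.mk_eq_zero _).2 ?_
      change z • n ∈ _
      rw [mem_ker_lsmul.1 hn]
      exact zero_mem _
  · intro u
    obtain ⟨u, rfl⟩ := Submodule.mkQ_surjective _ u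
    constructor
    · intro hu
      have hmem : Z.mkQ u ∈ (I ^ (k + 1) • ⊤ : Submodule R (M ⧸ Z)) :=
        (Submodule.Quotient.mk_eq_zero _).1 hu
      rw [hZ] at hmem
      obtain ⟨w, hw, hwu⟩ := hmem
      obtain ⟨y, hy⟩ := (Submodule.Quotient.eq _).1 hwu.symm
      refine ⟨Submodule.mkQ _ y, (Submodule.Quotient.eq _).2 ?_⟩
      rw [hy]
      simpa using hw
    · rintro ⟨y, hu⟩
      obtain ⟨y, rfl⟩ := Submodule.mkQ_surjective _ y
      rw [← hu]
      refine (Submodule.Quotient.mk_eq_zero _).2 ?_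
      have h₀ : Z.mkQ (z • y) = 0 := (Submodule.Quotient.mk_eq_zero _).2 ⟨y, rfl⟩
      change Z.mkQ (z • y) ∈ _
      rw [h₀]
      exact zero_mem _
  · intro u
    obtain ⟨u, rfl⟩ := Submodule.mkQ_surjective _ u
    obtain ⟨u, rfl⟩ := Submodule.mkQ_surjective _ u
    exact ⟨Submodule.mkQ _ u, rfl⟩

end IsSuperficial

lemma pow_smul_top_congr {J : Ideal R} (h : I ⊔ Module.annihilator R M = J ⊔ Module.annihilator R M)
    (k : ℕ) : (I ^ k • ⊤ : Submodule R M) = J ^ k • ⊤ := by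
  have key : ∀ I J : Ideal R, I ≤ J ⊔ Module.annihilator R M →
      (I ^ k • ⊤ : Submodule R M) ≤ J ^ k • ⊤ := by
    intro I J h
    induction k with
    | zero => simp
    | succ k ih =>
      rw [pow_succ', pow_succ', Submodule.mul_smul, Submodule.mul_smul]
      refine (Submodule.smul_mono h ih).trans ?_
      rw [Submodule.sup_smul]
      refine sup_le le_rfl ?_
      rw [Submodule.smul_le]
      intro r hr n _
      rw [Module.mem_annihilator.1 hr]
      exact zero_mem _
  exact le_antisymm (key I J (le_sup_left.trans h.le)) (key J I (le_sup_left.trans h.ge))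

end HilbertFunction

/-! ### From the growth of differences to the growth of a sequence. -/

section Analysis

lemma tendsto_sub_pow_div (d : ℕ) :
    Tendsto (fun k : ℕ => (((k : ℝ) + 1) ^ (d + 1) - (k : ℝ) ^ (d + 1)) / ((k : ℝ) + 1) ^ d)
      atTop (𝓝 (d + 1)) := by
  have h₁ : Tendsto (fun k : ℕ => (k : ℝ) / ((k : ℝ) + 1)) atTop (𝓝 1) :=
    tendsto_natCast_div_add_atTop 1
  have h₂ : Tendsto (fun k : ℕ => ∑ i ∈ Finset.range (d + 1), ((k : ℝ) / ((k : ℝ) + 1)) ^ (d - i))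
      atTop (𝓝 (∑ i ∈ Finset.range (d + 1), (1 : ℝ) ^ (d - i))) :=
    tendsto_finsetSum _ fun i _ => h₁.pow _
  simp only [one_pow, Finset.sum_const, Finset.card_range, nsmul_eq_mul, mul_one, Nat.cast_add,
    Nat.cast_one] at h₂
  refine h₂.congr fun k => ?_
  have hk : (k : ℝ) + 1 ≠ 0 := by positivity
  have h := (Commute.all ((k : ℝ) + 1) (k : ℝ)).geom_sum₂_mul (d + 1)
  rw [add_sub_cancel_left, mul_one] at h
  rw [← h, Finset.sum_div]
  refine Finset.sum_congr rfl fun i hi => ?_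
  have hi' : i ≤ d := by simpa [Nat.lt_succ_iff] using hi
  rw [div_pow, div_eq_div_iff (by positivity) (by positivity), Nat.add_sub_cancel]
  calc (k : ℝ) ^ (d - i) * ((k : ℝ) + 1) ^ d
      = (k : ℝ) ^ (d - i) * ((k : ℝ) + 1) ^ (i + (d - i)) := by rw [Nat.add_sub_cancel' hi']
    _ = _ := by rw [pow_add]; ring

/-- A sequence whose differences grow like `L k^d` grows like `L k^(d+1) / (d+1)`. -/
lemma tendsto_div_pow_succ {a : ℕ → ℝ} {d : ℕ} {L : ℝ}
    (h : Tendsto (fun k : ℕ => (a (k + 1) - a k) / ((k : ℝ) + 1) ^ d) atTop (𝓝 L)) :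
    Tendsto (fun k : ℕ => ((d : ℝ) + 1) * a k / (k : ℝ) ^ (d + 1)) atTop (𝓝 L) := by
  let b : ℕ → ℝ := fun k => (k : ℝ) ^ (d + 1)
  let Δ : ℕ → ℝ := fun k => b (k + 1) - b k
  have hd : (d : ℝ) + 1 ≠ 0 := by positivity
  have hpos : ∀ k, 0 < Δ k := fun k => by
    simp only [Δ, b, sub_pos, Nat.cast_add, Nat.cast_one]
    gcongr
    linarith
  have hb : Tendsto b atTop atTop :=
    (tendsto_pow_atTop (by omega)).comp tendsto_natCast_atTop_atTop
  -- Stolz–Cesàro: the differences of a are compared with those of (L/(d+1)) k^(d+1), and the o(Δ)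
  -- error is summed.
  have hlim : Tendsto (fun k => (a (k + 1) - a k - L / (d + 1) * Δ k) / Δ k) atTop (𝓝 0) := by
    have h' := (h.div (tendsto_sub_pow_div d) hd).sub_const (L / (d + 1))
    rw [sub_self] at h'
    refine h'.congr fun k => ?_
    have hk : ((k : ℝ) + 1) ^ d ≠ 0 := by positivity
    have hΔ : ((k : ℝ) + 1) ^ (d + 1) - (k : ℝ) ^ (d + 1) = Δ k := by simp [Δ, b]
    rw [Pi.div_apply, hΔ]
    have := (hpos k).ne'
    field_simp
  have ho : (fun k => a (k + 1) - a k - L / (d + 1) * Δ k) =o[atTop] Δ :=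
    (isLittleO_iff_tendsto fun k hk => absurd hk (hpos k).ne').2 hlim
  have hsum : ∀ n, ∑ k ∈ Finset.range n, Δ k = b n := fun n => by
    rw [Finset.sum_range_sub]; simp [b]
  have ho' := ho.sum_range (fun k => (hpos k).le) (by simpa only [hsum] using hb)
  have hsum' : ∀ n, ∑ k ∈ Finset.range n, (a (k + 1) - a k - L / (d + 1) * Δ k) =
      a n - a 0 - L / (d + 1) * b n := fun n => by
    rw [Finset.sum_sub_distrib, Finset.sum_range_sub, ← Finset.mul_sum, hsum]
  simp only [hsum, hsum'] at ho'
  have hev : ∀ᶠ n : ℕ in atTop, b n ≠ 0 := by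
    filter_upwards [eventually_gt_atTop 0] with n hn
    simp [b]
    omega
  have h₁ := ho'.tendsto_div_nhds_zero
  have h₂ : Tendsto (fun n => a 0 / b n) atTop (𝓝 0) := hb.const_div_atTop (a 0)
  have h₃ := ((h₁.add h₂).add_const (L / (d + 1))).const_mul ((d : ℝ) + 1)
  rw [add_zero, zero_add, mul_div_cancel₀ _ hd] at h₃
  refine h₃.congr' ?_
  filter_upwards [hev] with n hn
  change _ = ((d : ℝ) + 1) * a n / b n
  field_simp
  ring

end Analysis

/-! ### Samuel's theorem: the symbol as a leading coefficient. -/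

section Samuel

variable {R : Type u} [CommRing R] {M : Type v} [AddCommGroup M] [Module R M]

lemma mult_eq_zero_of_subsingleton (xs : List R) [Subsingleton M] : mult xs M = 0 := by
  induction xs generalizing M with
  | nil => simp [mult, Module.length_eq_zero]
  | cons x xs ih =>
    have : Subsingleton (M ⧸ LinearMap.range (LinearMap.lsmul R M x)) :=
      (Submodule.mkQ_surjective _).subsingleton
    simp only [mult, ih, sub_zero]

lemma mult_cons_eq_zero_of_isUnit {u : R} (hu : IsUnit u) (xs : List R) :
    mult (u :: xs) M = 0 := by
  obtain ⟨u, rfl⟩ := hu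
  have h₁ : Subsingleton (M ⧸ LinearMap.range (LinearMap.lsmul R M (u : R))) := by
    rw [Submodule.Quotient.subsingleton_iff, LinearMap.range_eq_top]
    exact fun m => ⟨(↑u⁻¹ : R) • m, by simp [smul_smul]⟩
  have h₂ : Subsingleton (LinearMap.ker (LinearMap.lsmul R M (u : R))) := by
    rw [Submodule.subsingleton_iff_eq_bot, Submodule.eq_bot_iff]
    intro m hm
    have := congrArg ((↑u⁻¹ : R) • ·) (mem_ker_lsmul.1 hm)
    simpa [smul_smul] using this
  simp only [mult, mult_eq_zero_of_subsingleton, sub_zero]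

lemma sup_pow_le_pow_sup (I J : Ideal R) (k : ℕ) : (I ⊔ J) ^ k ≤ I ^ k ⊔ J := by
  induction k with
  | zero => simp
  | succ k ih =>
    rw [pow_succ, pow_succ]
    refine (Ideal.mul_mono_left ih).trans ?_
    rw [Ideal.sup_mul]
    refine sup_le ?_ ((Ideal.mul_le_left (I := J) (J := I ⊔ J)).trans le_sup_right)
    rw [Ideal.mul_sup]
    exact sup_le le_sup_left ((Ideal.mul_le_right (I := I ^ k) (J := J)).trans le_sup_right)

lemma le_annihilator_quotient_smul_top (I : Ideal R) :
    I ⊔ Module.annihilator R M ≤ Module.annihilator R (M ⧸ (I • ⊤ : Submodule R M)) := by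
  refine sup_le (fun r hr => ?_)
    (LinearMap.annihilator_le_of_surjective _ (Submodule.mkQ_surjective _))
  rw [Module.mem_annihilator]
  intro m
  obtain ⟨m, rfl⟩ := Submodule.mkQ_surjective _ m
  exact (Submodule.Quotient.mk_eq_zero _).2 (Submodule.smul_mem_smul hr trivial)

section Local

variable [IsLocalRing R]

/-- Outside 𝔪I some coefficient in an expression by the generators is a unit, so the element can
replace that generator. -/
lemma exists_perm_cons_of_notMem {zs : List R} {z : R} (hz : z ∈ Ideal.ofList zs)
    (hz' : z ∉ maximalIdeal R * Ideal.ofList zs) :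
    ∃ a rest u r, IsUnit u ∧ zs.Perm (a :: rest) ∧ r ∈ Ideal.ofList rest ∧ z = u * a + r := by
  induction zs generalizing z with
  | nil =>
    rw [Ideal.ofList_nil] at hz
    exact absurd (by rw [(Submodule.mem_bot R).1 hz]; exact zero_mem _) hz'
  | cons x xs ih =>
    rw [Ideal.ofList_cons] at hz
    obtain ⟨y, hy, w, hw, rfl⟩ := Submodule.mem_sup.1 hz
    obtain ⟨α, rfl⟩ := Ideal.mem_span_singleton'.1 hy
    by_cases hα : IsUnit α
    · exact ⟨x, xs, α, w, hα, List.Perm.refl _, hw, rfl⟩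
    · have h₁ : α * x ∈ maximalIdeal R * Ideal.ofList (x :: xs) :=
        Ideal.mul_mem_mul ((IsLocalRing.mem_maximalIdeal _).2 hα) (Ideal.subset_span (by simp))
      have hw' : w ∉ maximalIdeal R * Ideal.ofList xs := fun h =>
        hz' (add_mem h₁ (Ideal.mul_mono_right (by rw [Ideal.ofList_cons]; exact le_sup_right) h))
      obtain ⟨a, rest, u, r, hu, hp, hr, rfl⟩ := ih hw hw'
      refine ⟨a, x :: rest, u, α * x + r, hu, (hp.cons x).trans (List.Perm.swap _ _ _), ?_, by ring⟩
      rw [Ideal.ofList_cons]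
      exact add_mem (Ideal.mem_sup_left (Ideal.mul_mem_left _ _ (Ideal.mem_span_singleton_self x)))
        (Ideal.mem_sup_right hr)

variable [IsNoetherianRing R]

lemma IsParam.isFiniteLength_quotient {zs : List R} (h : IsParam zs M) {I : Ideal R}
    (hI : Ideal.ofList zs ≤ I) (k : ℕ) : IsFiniteLength R (M ⧸ (I ^ k • ⊤ : Submodule R M)) := by
  have := h.finite
  obtain ⟨l, hl⟩ := h.exists_pow_le
  refine isFiniteLength_of_pow_le_annihilator (k := l * k) ?_
  rw [pow_mul]
  exact (Ideal.pow_right_mono (hl.trans (sup_le_sup_right hI _)) k).trans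
    ((sup_pow_le_pow_sup _ _ k).trans (le_annihilator_quotient_smul_top _))

lemma IsParam.coe_hilbertFn {zs : List R} (h : IsParam zs M) {I : Ideal R}
    (hI : Ideal.ofList zs ≤ I) (k : ℕ) :
    (hilbertFn I M k : ℕ∞) = Module.length R (M ⧸ (I ^ k • ⊤ : Submodule R M)) :=
  ENat.natCast_toNat (Module.length_ne_top_iff.2 (h.isFiniteLength_quotient hI k))

/-- The summand r disappears modulo the remaining entries, and the unit contributes zero in
`mult_mul_cons`. -/
lemma mult_cons_of_isUnit_mul_add {rest : List R} {a u r : R} (hu : IsUnit u)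
    (hr : r ∈ Ideal.ofList rest) (h : IsParam (a :: rest) M) :
    Ideal.ofList ((u * a + r) :: rest) = Ideal.ofList (a :: rest) ∧
      mult ((u * a + r) :: rest) M = mult (a :: rest) M := by
  have hI : Ideal.ofList ((u * a + r) :: rest) = Ideal.ofList (a :: rest) := by
    rw [Ideal.ofList_cons, Ideal.ofList_cons]
    refine le_antisymm (sup_le ?_ le_sup_right) (sup_le ?_ le_sup_right) <;>
      rw [Ideal.span_singleton_le_iff_mem]
    · exact add_mem (Ideal.mem_sup_left (Ideal.mul_mem_left _ _ (Ideal.mem_span_singleton_self a)))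
        (Ideal.mem_sup_right hr)
    · rw [← Ideal.unit_mul_mem_iff_mem _ hu]
      exact (Submodule.add_mem_iff_left _ (Ideal.mem_sup_right hr)).1
        (Ideal.mem_sup_left (Ideal.mem_span_singleton_self _))
  refine ⟨hI, ?_⟩
  have h' : IsParam ((u * a + r) :: rest) M := h.mono (hI.ge.trans le_sup_left)
  have h₁ : mult ((u * a + r) :: rest) M = mult (u * a :: rest) M :=
    mult_cons_congr h' (Ideal.mem_sup_left (by simpa using hr))
  have h₂ : IsParam (u * a :: rest) M := by
    refine h.mono (le_trans ?_ le_sup_left)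
    rw [Ideal.ofList_cons, Ideal.ofList_cons]
    refine sup_le_sup_right (Ideal.span_singleton_le_span_singleton.2 ?_) _
    exact (hu.mul_left_dvd).2 dvd_rfl
  rw [h₁, mult_mul_cons h₂, mult_cons_eq_zero_of_isUnit hu, zero_add]

variable [Infinite (ResidueField R)]

/-- A generating list of an ideal can be changed, without changing the multiplicity symbol, such
that its first element is superficial. -/
lemma exists_superficial_cons {zs : List R} (hne : zs ≠ []) (hm : ∀ z ∈ zs, z ∈ maximalIdeal R)
    (h : IsParam zs M) : ∃ z rest c, rest.length + 1 = zs.length ∧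
      Ideal.ofList (z :: rest) = Ideal.ofList zs ∧ mult (z :: rest) M = mult zs M ∧
      (∀ y ∈ rest, y ∈ maximalIdeal R) ∧ IsSuperficial (Ideal.ofList zs) M z c := by
  have := h.finite
  -- If I ≤ 𝔪I, nothing in I avoids 𝔪I; but then I = 0, and any entry is superficial from degree 1
  -- on because I^j M = 0 there.
  by_cases hI : Ideal.ofList zs ≤ maximalIdeal R * Ideal.ofList zs
  · have hbot : Ideal.ofList zs = ⊥ := Submodule.eq_bot_of_le_smul_of_le_jacobson_bot
      (maximalIdeal R) _ (IsNoetherian.noetherian _) hI (IsLocalRing.maximalIdeal_le_jacobson _)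
    obtain ⟨a, rest, rfl⟩ := List.exists_cons_of_ne_nil hne
    refine ⟨a, rest, 1, rfl, rfl, rfl, fun y hy => hm y (List.mem_cons_of_mem _ hy), ?_⟩
    intro j hj u hu _
    rw [hbot, ← Nat.succ_pred_eq_of_pos hj, Nat.succ_eq_add_one, pow_succ', Ideal.bot_mul,
      Submodule.bot_smul, Submodule.mem_bot] at hu
    rw [hu]
    exact zero_mem _
  · obtain ⟨z, hz, hzm, c, hc⟩ := exists_superficial (Ideal.ofList zs) M
      (𝒲 := {maximalIdeal R * Ideal.ofList zs}) (Set.finite_singleton _) (by simpa using hI)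
    obtain ⟨a, rest, u, r, hu, hp, hr, rfl⟩ := exists_perm_cons_of_notMem hz (hzm _ rfl)
    obtain ⟨h₁, h₂⟩ := mult_cons_of_isUnit_mul_add hu hr (h.perm hp)
    exact ⟨_, rest, c, hp.length_eq.symm, h₁.trans (ofList_perm hp).symm,
      h₂.trans (mult_perm hp h).symm, fun y hy => hm y (hp.mem_iff.2 (List.mem_cons_of_mem _ hy)),
      hc⟩

/-- **Samuel's theorem**: the multiplicity symbol is the normalized leading coefficient of the
Hilbert--Samuel function of the ideal generated by the list. -/
theorem tendsto_hilbertFn {zs : List R} (h : IsParam zs M) (hm : ∀ z ∈ zs, z ∈ maximalIdeal R) :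
    Tendsto (fun k : ℕ => (zs.length.factorial : ℝ) * hilbertFn (Ideal.ofList zs) M k /
      (k : ℝ) ^ zs.length) atTop (𝓝 (mult zs M : ℝ)) := by
  induction hd : zs.length generalizing zs M with
  | zero =>
    rw [List.length_eq_zero_iff] at hd
    subst hd
    refine tendsto_const_nhds.congr' ?_
    filter_upwards [eventually_gt_atTop 0] with k hk
    have : ((Ideal.ofList ([] : List R)) ^ k • ⊤ : Submodule R M) = ⊥ := by
      rw [Ideal.ofList_nil, ← Nat.succ_pred_eq_of_pos hk, Nat.succ_eq_add_one, pow_succ',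
        Ideal.bot_mul, Submodule.bot_smul]
    simp [hilbertFn, mult, (Submodule.quotEquivOfEqBot _ this).length_eq]
  | succ d ih =>
    have hne : zs ≠ [] := by rintro rfl; simp at hd
    obtain ⟨z, rest, c, hlen, hI, hmult, hrest, hsup⟩ := exists_superficial_cons hne hm h
    have hfin := h.finite
    have h' : IsParam (z :: rest) M := h.mono (hI.ge.trans le_sup_left)
    have hlen' : rest.length = d := by omega
    have hItop : Ideal.ofList zs ≠ ⊤ := fun htop => by
      have : Ideal.ofList zs ≤ maximalIdeal R := Ideal.span_le.2 fun z hz => hm z hz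
      rw [htop, top_le_iff] at this
      exact (maximalIdeal.isMaximal R).ne_top this
    have hz : z ∈ Ideal.ofList zs := by
      rw [← hI, Ideal.ofList_cons]
      exact Ideal.mem_sup_left (Ideal.mem_span_singleton_self z)
    obtain ⟨k₀, hk₀⟩ := hsup.exists_length_eq hz hItop
    let N := LinearMap.ker (LinearMap.lsmul R M z)
    let Q := M ⧸ LinearMap.range (LinearMap.lsmul R M z)
    have hQ := ih h'.quotient hrest hlen'
    have hN := ih h'.ker hrest hlen'
    -- On modules killed by z, the ideals (rest) and (zs) define the same adic filtration.
    have hsub : ∀ {P : Type v} [AddCommGroup P] [Module R P], z ∈ Module.annihilator R P →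
        Ideal.ofList rest ⊔ Module.annihilator R P = Ideal.ofList zs ⊔ Module.annihilator R P := by
      intro P _ _ hP
      rw [← hI, Ideal.ofList_cons, sup_assoc]
      exact (sup_eq_right.2
        (((Ideal.span_singleton_le_iff_mem _).2 hP).trans le_sup_right)).symm
    have hev : ∀ᶠ k : ℕ in atTop, (hilbertFn (Ideal.ofList zs) M (k + 1) : ℝ) -
        hilbertFn (Ideal.ofList zs) M k =
          hilbertFn (Ideal.ofList rest) Q (k + 1) - hilbertFn (Ideal.ofList rest) N (k + 1) := by
      filter_upwards [eventually_ge_atTop k₀, eventually_ge_atTop c] with k hk hkc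
      -- I^(k+1)(0 : z) lies in (0 : z) ∩ I^(k+1) M = 0. The constant ℓ(0 : z) is thus a value of
      -- the kernel's own Hilbert function, so the difference of Hilbert functions mirrors the
      -- recursion for `mult`.
      have hlenN : Module.length R (N ⧸ (Ideal.ofList rest ^ (k + 1) • ⊤ : Submodule R N)) =
          Module.length R N := by
        refine (Submodule.quotEquivOfEqBot _ ?_).length_eq
        rw [pow_smul_top_congr (hsub (mem_annihilator_ker_lsmul z)), Submodule.eq_bot_iff]
        intro n hn
        have hn' : n.1 ∈ N ⊓ (Ideal.ofList zs ^ (k + 1) • ⊤ : Submodule R M) :=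
          ⟨n.2, Submodule.smul_mono le_rfl le_top ((Submodule.mem_smul_top_iff _ _ _).1 hn)⟩
        rw [hsup.ker_inf_eq_bot hItop (by omega)] at hn'
        exact Subtype.ext hn'
      have e := hk₀ k hk
      rw [← pow_smul_top_congr (hsub (mem_annihilator_quotient_lsmul z)), ← hlenN,
        ← h.coe_hilbertFn le_rfl, ← h.coe_hilbertFn le_rfl, ← h'.quotient.coe_hilbertFn le_rfl,
        ← h'.ker.coe_hilbertFn le_rfl] at e
      have e' : (hilbertFn (Ideal.ofList rest) N (k + 1) : ℝ) +
          hilbertFn (Ideal.ofList zs) M (k + 1) = hilbertFn (Ideal.ofList zs) M k +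
          hilbertFn (Ideal.ofList rest) Q (k + 1) := by exact_mod_cast e
      linarith
    have hlim := ((hQ.sub hN).comp (tendsto_add_atTop_nat 1))
    have hfinal := tendsto_div_pow_succ (d := d) (L := (mult zs M : ℝ))
      (a := fun k => (d.factorial : ℝ) * hilbertFn (Ideal.ofList zs) M k) (by
        rw [← hmult]
        simp only [mult, Int.cast_sub]
        refine hlim.congr' ?_
        filter_upwards [hev] with k hk
        rw [← mul_sub, hk]
        simp only [Function.comp_apply, Nat.cast_add, Nat.cast_one]
        ring)
    refine hfinal.congr fun k => ?_
    rw [Nat.factorial_succ]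
    push_cast
    ring

/-- The recursion subtracts, so the sign is not visible from it; it comes from Samuel's limit. -/
theorem mult_nonneg {zs : List R} (h : IsParam zs M) (hm : ∀ z ∈ zs, z ∈ maximalIdeal R) :
    0 ≤ mult zs M := by
  have : (0 : ℝ) ≤ mult zs M :=
    ge_of_tendsto' (tendsto_hilbertFn h hm) fun k => by positivity
  exact_mod_cast this

end Local

end Samuel

/-! ### Reductions of the maximal ideal reachable by exchanges. -/

section Reduction

variable {R : Type u} [CommRing R] [IsLocalRing R]

/-- Exchanging the entries of `xs` for those of `ys` one after the other, from the left, keeps the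
ideal generated together with `J` primary to the maximal ideal. -/
def IsExchange : Ideal R → List R → List R → Prop
  | _, [], ys => ys = []
  | J, _ :: xs, ys => ∃ y ys', ys = y :: ys' ∧
      (∃ k, maximalIdeal R ^ k ≤ J ⊔ Ideal.span {y} ⊔ Ideal.ofList xs) ∧
      IsExchange (J ⊔ Ideal.span {y}) xs ys'

variable [IsNoetherianRing R]

/-- Since 𝔪 is minimal over K + (x), Krull's principal ideal theorem makes every prime Q with K ≤ Q
< 𝔪 minimal over K. Such a Q cannot contain y, so only 𝔪 can lie over K + (y). -/
lemma exists_pow_le_sup_span_singleton {K : Ideal R} {x y : R} (hx : x ∈ maximalIdeal R)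
    (h : ∃ k, maximalIdeal R ^ k ≤ Ideal.span {x} ⊔ K)
    (hy : ∀ P ∈ K.minimalPrimes, ¬ maximalIdeal R ≤ P → y ∉ P) :
    ∃ k, maximalIdeal R ^ k ≤ K ⊔ Ideal.span {y} := by
  refine Ideal.exists_pow_le_of_le_radical_of_fg ?_ (IsNoetherian.noetherian _)
  rw [← Ideal.sInf_minimalPrimes]
  refine le_sInf fun Q hQ => ?_
  by_contra hm
  have hprime := hQ.isPrime
  have hKQ : K ≤ Q := le_sup_left.trans hQ.le
  have hQm : Q < maximalIdeal R :=
    lt_of_le_not_ge (IsLocalRing.le_maximalIdeal hprime.ne_top) hm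
  obtain ⟨k, hk⟩ := h
  have hspan : Ideal.span (insert x (K : Set R)) = Ideal.span {x} ⊔ K := by
    rw [Ideal.span_insert, Ideal.span_eq]
  refine hy Q ?_ hm (hQ.le (Ideal.mem_sup_right (Ideal.mem_span_singleton_self y)))
  rw [← Ideal.span_eq K]
  refine Ideal.mem_minimalPrimes_span_of_mem_minimalPrimes_span_insert hQm x (K : Set R) ?_ _ hKQ
    (fun a ha => Ideal.le_radical (Ideal.subset_span (Set.mem_insert_of_mem _ ha)))
  rw [hspan]
  refine ⟨⟨inferInstance, sup_le ((Ideal.span_singleton_le_iff_mem _).2 hx)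
    (hKQ.trans hQm.le)⟩, fun P hP _ => ?_⟩
  have := hP.1
  exact Ideal.IsPrime.le_of_pow_le (hk.trans hP.2)

section Growth

variable (M : Type v) [AddCommGroup M] [Module R M] [Module.Finite R M]

lemma isFiniteLength_quotient_maximalIdeal_pow (k : ℕ) :
    IsFiniteLength R (M ⧸ (maximalIdeal R ^ k • ⊤ : Submodule R M)) :=
  isFiniteLength_of_pow_le_annihilator (k := k)
    (le_sup_left.trans (le_annihilator_quotient_smul_top _))

lemma coe_hilbertFn_maximalIdeal (k : ℕ) : (hilbertFn (maximalIdeal R) M k : ℕ∞) =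
    Module.length R (M ⧸ (maximalIdeal R ^ k • ⊤ : Submodule R M)) :=
  ENat.natCast_toNat (Module.length_ne_top_iff.2 (isFiniteLength_quotient_maximalIdeal_pow M k))

lemma hilbertFn_maximalIdeal_mono : Monotone (hilbertFn (maximalIdeal R) M) := by
  intro k l h
  rw [← Nat.cast_le (α := ℕ∞), coe_hilbertFn_maximalIdeal, coe_hilbertFn_maximalIdeal]
  exact Module.length_le_of_surjective
    (Submodule.factor (pow_smul_top_antitone (maximalIdeal R) M h)) (Submodule.factor_surjective _)

/-- By Nakayama the Hilbert function increases strictly as long as 𝔪^n M is nonzero. -/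
lemma exists_pow_smul_eq_bot_of_bounded {C : ℕ} (hC : ∀ k, hilbertFn (maximalIdeal R) M k ≤ C) :
    ∃ n, (maximalIdeal R ^ n • ⊤ : Submodule R M) = ⊥ := by
  by_contra! hne
  have key : ∀ n, n ≤ hilbertFn (maximalIdeal R) M n := by
    intro n
    induction n with
    | zero => exact Nat.zero_le _
    | succ n ih =>
      refine lt_of_le_of_lt ih ?_
      have hle : (maximalIdeal R ^ (n + 1) • ⊤ : Submodule R M) ≤ maximalIdeal R ^ n • ⊤ :=
        pow_smul_top_antitone (maximalIdeal R) M (Nat.le_succ n)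
      let π := Submodule.factor hle
      have hlen := Module.length_eq_add_of_exact (LinearMap.ker π).subtype π
        (Submodule.subtype_injective _) (Submodule.factor_surjective _)
        (LinearMap.exact_subtype_ker_map _)
      have hpos : 0 < Module.length R (LinearMap.ker π) := by
        rw [Module.length_pos_iff, Submodule.nontrivial_iff_ne_bot]
        intro hbot
        refine hne n (Submodule.eq_bot_of_le_smul_of_le_jacobson_bot (maximalIdeal R) _
          (IsNoetherian.noetherian _) (fun u hu => ?_)
          (IsLocalRing.maximalIdeal_le_jacobson _))
        have h₁ : Submodule.mkQ _ u ∈ LinearMap.ker π := (Submodule.Quotient.mk_eq_zero _).2 hu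
        rw [hbot] at h₁
        have h₂ := (Submodule.Quotient.mk_eq_zero _).1 ((Submodule.mem_bot R).1 h₁)
        rwa [pow_succ', Submodule.mul_smul] at h₂
      rw [← Nat.cast_lt (α := ℕ∞), coe_hilbertFn_maximalIdeal, coe_hilbertFn_maximalIdeal, hlen]
      have hne' := Module.length_ne_top_iff.2 (isFiniteLength_quotient_maximalIdeal_pow (R := R) M n)
      rw [add_comm]
      exact (ENat.lt_add_one_iff hne').2 le_rfl |>.trans_le
        (add_le_add_right (Order.one_le_iff_pos.2 hpos) _)
  have := (key (C + 1)).trans (hC (C + 1))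
  omega

variable {M}

/-- Passing to M/zM lowers the order of growth by one: its Hilbert function g is, up to the constant
ℓ(0 : z), the difference of that of M, and g is monotone, so summing over a range of length about k
bounds k g(k). -/
lemma IsSuperficial.growth {z : R} {c : ℕ} (h : IsSuperficial (maximalIdeal R) M z c)
    (hz : z ∈ maximalIdeal R) {d C : ℕ}
    (hC : ∀ᶠ k in atTop, hilbertFn (maximalIdeal R) M k ≤ C * k ^ (d + 1)) :
    ∃ C', ∀ᶠ k in atTop,
      hilbertFn (maximalIdeal R) (M ⧸ LinearMap.range (LinearMap.lsmul R M z)) k ≤ C' * k ^ d := by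
  obtain ⟨k₀, hk₀⟩ := h.exists_length_eq hz (maximalIdeal.isMaximal R).ne_top
  let Q := M ⧸ LinearMap.range (LinearMap.lsmul R M z)
  let f := hilbertFn (maximalIdeal R) M
  let g := hilbertFn (maximalIdeal R) Q
  let N := (Module.length R (LinearMap.ker (LinearMap.lsmul R M z))).toNat
  have hg : Monotone g := hilbertFn_maximalIdeal_mono (R := R) Q
  have hN : (N : ℕ∞) = Module.length R (LinearMap.ker (LinearMap.lsmul R M z)) := by
    -- The kernel has finite length because the right-hand side of the length identity is finite.
    refine ENat.natCast_toNat fun htop => ?_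
    have e := hk₀ k₀ le_rfl
    rw [htop, top_add] at e
    have h₁ := coe_hilbertFn_maximalIdeal (R := R) M k₀
    have h₂ := coe_hilbertFn_maximalIdeal (R := R) Q (k₀ + 1)
    rw [← h₁, ← h₂] at e
    exact absurd e.symm (by exact_mod_cast ENat.natCast_ne_top _)
  have hrec : ∀ k ≥ k₀, N + f (k + 1) = f k + g (k + 1) := fun k hk => by
    have e := hk₀ k hk
    rw [← hN, ← coe_hilbertFn_maximalIdeal, ← coe_hilbertFn_maximalIdeal,
      ← coe_hilbertFn_maximalIdeal] at e
    exact_mod_cast e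
  have hiter : ∀ k ≥ k₀, ∀ n, f k + n * g (k + 1) ≤ f (k + n) + n * N := by
    intro k hk n
    induction n with
    | zero => simp
    | succ n ih =>
      have e := hrec (k + n) (by omega)
      have hm : g (k + 1) ≤ g (k + n + 1) := hg (by omega)
      rw [← add_assoc k n 1]
      linarith
  -- The sum reaches argument 2k - 1, whence the factor 2^(d+1); N pays for the kernel in each step.
  refine ⟨C * 2 ^ (d + 1) + N, ?_⟩
  have htend : Tendsto (fun k : ℕ => 2 * k - 1) atTop atTop :=
    tendsto_atTop_mono (fun k => by omega : ∀ k, k - 1 ≤ 2 * k - 1) (tendsto_sub_atTop_nat 1)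
  filter_upwards [htend.eventually hC, eventually_ge_atTop (k₀ + 1)] with k hk hkk
  obtain ⟨k, rfl⟩ : ∃ j, k = j + 1 := ⟨k - 1, by omega⟩
  have h₁ := hiter k (by omega) (k + 1)
  rw [show 2 * (k + 1) - 1 = k + (k + 1) by omega] at hk
  have h₂ : (k + (k + 1)) ^ (d + 1) ≤ (2 * (k + 1)) ^ (d + 1) := Nat.pow_le_pow_left (by omega) _
  have h₃ : (k + 1) * g (k + 1) ≤ (k + 1) * (C * 2 ^ (d + 1) * (k + 1) ^ d + N) := by
    calc (k + 1) * g (k + 1) ≤ f (k + (k + 1)) + (k + 1) * N := by omega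
      _ ≤ C * (2 * (k + 1)) ^ (d + 1) + (k + 1) * N := by
        gcongr
        exact hk.trans (Nat.mul_le_mul_left _ h₂)
      _ = _ := by rw [mul_pow, pow_succ (k + 1)]; ring
  have h₄ := Nat.le_of_mul_le_mul_left h₃ (Nat.succ_pos k)
  have h₅ : 1 ≤ (k + 1) ^ d := Nat.one_le_pow _ _ (Nat.succ_pos k)
  change g (k + 1) ≤ _
  nlinarith

end Growth

variable [Infinite (ResidueField R)]

/-- Existence of a reduction of the maximal ideal that is linked to a given list of parameters. -/
theorem exists_reduction {xs : List R} (hxs : ∀ x ∈ xs, x ∈ maximalIdeal R) (J : Ideal R)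
    (hJ : ∃ k, maximalIdeal R ^ k ≤ J ⊔ Ideal.ofList xs)
    (M : Type v) [AddCommGroup M] [Module R M] [Module.Finite R M] {C : ℕ}
    (hC : ∀ᶠ k in atTop, hilbertFn (maximalIdeal R) M k ≤ C * k ^ xs.length) :
    ∃ ys : List R, (∀ y ∈ ys, y ∈ maximalIdeal R) ∧ IsExchange J xs ys ∧
      ∃ n₀, ∀ n ≥ n₀, (maximalIdeal R ^ (n + 1) • ⊤ : Submodule R M) ≤
        Ideal.ofList ys • (maximalIdeal R ^ n • ⊤ : Submodule R M) := by
  induction xs generalizing J M C with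
  | nil =>
    -- Growth of order zero means a bounded Hilbert function, so 𝔪^n M = 0 and the empty list
    -- already works.
    obtain ⟨k₁, hk₁⟩ := eventually_atTop.1 hC
    obtain ⟨n, hn⟩ := exists_pow_smul_eq_bot_of_bounded M (C := C) fun k => by
      refine (hilbertFn_maximalIdeal_mono (R := R) M (le_max_left k k₁)).trans ?_
      simpa using hk₁ _ (le_max_right k k₁)
    refine ⟨[], by simp, rfl, n, fun m hm => ?_⟩
    exact (pow_smul_top_antitone _ M (by omega : n ≤ m + 1)).trans (hn.le.trans bot_le)
  | cons x xs ih =>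
    -- The same z is superficial for M, which serves the reduction, and avoids the non-maximal
    -- minimal primes of J + (xs), which keeps the exchanged list 𝔪-primary.
    obtain ⟨z, hz, hzW, c, hc⟩ := exists_superficial (maximalIdeal R) M
      (𝒲 := {P ∈ (J ⊔ Ideal.ofList xs).minimalPrimes | ¬ maximalIdeal R ≤ P})
      ((Ideal.finite_minimalPrimes_of_isNoetherianRing R _).subset (Set.sep_subset _ _))
      (fun P hP => hP.2)
    have hsup : IsSuperficial (maximalIdeal R) M z c := hc
    have hprim : ∃ k, maximalIdeal R ^ k ≤ J ⊔ Ideal.span {z} ⊔ Ideal.ofList xs := by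
      obtain ⟨k, hk⟩ := exists_pow_le_sup_span_singleton (K := J ⊔ Ideal.ofList xs) (y := z)
        (hxs x (by simp)) (by
          obtain ⟨k, hk⟩ := hJ
          rw [Ideal.ofList_cons] at hk
          exact ⟨k, hk.trans (sup_le (le_sup_left.trans le_sup_right)
            (sup_le le_sup_left (le_sup_right.trans le_sup_right)))⟩)
        (fun P hP hm => hzW P ⟨hP, hm⟩)
      exact ⟨k, hk.trans (by rw [sup_right_comm])⟩
    obtain ⟨C', hC'⟩ := hsup.growth hz hC
    let Z := LinearMap.range (LinearMap.lsmul R M z)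
    obtain ⟨ys, hys, hex, n₀, hn₀⟩ := ih (fun y hy => hxs y (List.mem_cons_of_mem _ hy))
      (J ⊔ Ideal.span {z}) hprim (M ⧸ Z) hC'
    obtain ⟨k₀, -, hk₀⟩ := hsup.exists_smul_eq
    refine ⟨z :: ys, ?_, ⟨z, ys, rfl, hprim, hex⟩, max n₀ k₀, fun n hn u hu => ?_⟩
    · simpa using ⟨hz, hys⟩
    have hmap : ∀ I : Ideal R, ∀ N : Submodule R M, (I • N).map Z.mkQ = I • N.map Z.mkQ :=
      fun I N => Submodule.map_smul'' _ _ _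
    have hbar : Z.mkQ u ∈ (Ideal.ofList ys • (maximalIdeal R ^ n • ⊤ : Submodule R M)).map Z.mkQ := by
      rw [hmap, hmap, Submodule.map_top, Submodule.range_mkQ]
      refine hn₀ n ((le_max_left _ _).trans hn) ?_
      have := Submodule.mem_map_of_mem (f := Z.mkQ) hu
      rwa [hmap, Submodule.map_top, Submodule.range_mkQ] at this
    obtain ⟨b, hb, hbu⟩ := hbar
    obtain ⟨v, hv⟩ := (Submodule.Quotient.eq _).1 hbu.symm
    replace hv : z • v = u - b := hv
    have hbm : b ∈ (maximalIdeal R ^ (n + 1) • ⊤ : Submodule R M) := by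
      rw [pow_succ', Submodule.mul_smul]
      exact Submodule.smul_mono_left (Ideal.span_le.2 fun y hy => hys y hy) hb
    -- Lifting from M/zM leaves the error u - b = z v in 𝔪^(n+1) M; superficiality replaces v by
    -- some w in 𝔪^n M.
    obtain ⟨w, hw, hzw⟩ := hk₀ n ((le_max_right _ _).trans hn) v (by
      rw [hv]; exact sub_mem hu hbm)
    rw [← sub_add_cancel u b, ← hv, hzw, Ideal.ofList_cons]
    refine add_mem ?_ (Submodule.smul_mono_left le_sup_right hb)
    exact Submodule.smul_mem_smul (Ideal.mem_sup_left (Ideal.mem_span_singleton_self z)) hw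

end Reduction

/-! ### The excess and its behaviour when one parameter is exchanged. -/

section Excess

variable {R : Type u} [CommRing R]

/-- The difference between the colength of `(xs) M` and the multiplicity symbol, in its recursive
form. -/
noncomputable def excess : List R → (M : Type v) → [AddCommGroup M] → [Module R M] → ℤ
  | [], _, _, _ => 0
  | x :: xs, M, _, _ =>
    excess xs (M ⧸ LinearMap.range (LinearMap.lsmul R M x)) +
      mult xs (LinearMap.ker (LinearMap.lsmul R M x))

variable {M : Type v} [AddCommGroup M] [Module R M]

lemma ofList_cons_smul_top (x : R) (xs : List R) :
    (Ideal.ofList (x :: xs) • ⊤ : Submodule R M) =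
      LinearMap.range (LinearMap.lsmul R M x) ⊔ Ideal.ofList xs • ⊤ := by
  rw [Ideal.ofList_cons, Submodule.sup_smul]
  congr 1
  ext m
  simp [Submodule.ideal_span_singleton_smul, Submodule.mem_smul_pointwise_iff_exists]

/-- `M / (x, xs) M ≅ (M / x M) / (xs) (M / x M)`. -/
noncomputable def quotientConsEquiv (x : R) (xs : List R) :
    (M ⧸ (Ideal.ofList (x :: xs) • ⊤ : Submodule R M)) ≃ₗ[R]
      ((M ⧸ LinearMap.range (LinearMap.lsmul R M x)) ⧸
        (Ideal.ofList xs • ⊤ : Submodule R (M ⧸ LinearMap.range (LinearMap.lsmul R M x)))) :=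
  (Submodule.quotEquivOfEq _ _ (by
    have e : (Ideal.ofList xs • ⊤ : Submodule R (M ⧸ LinearMap.range (LinearMap.lsmul R M x))) =
        (Ideal.ofList xs • ⊤ : Submodule R M).map (Submodule.mkQ _) := by
      rw [Submodule.map_smul'', Submodule.map_top, Submodule.range_mkQ]
    rw [LinearMap.ker_comp, Submodule.ker_mkQ, e, Submodule.comap_map_eq, Submodule.ker_mkQ,
      ofList_cons_smul_top, sup_comm])).trans
    (LinearMap.quotKerEquivOfSurjective
      ((Submodule.mkQ (Ideal.ofList xs • ⊤ : Submodule R _)).comp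
        (Submodule.mkQ (LinearMap.range (LinearMap.lsmul R M x))))
      ((Submodule.mkQ_surjective _).comp (Submodule.mkQ_surjective _)))

lemma excess_eq (xs : List R) : excess xs M =
    ((Module.length R (M ⧸ (Ideal.ofList xs • ⊤ : Submodule R M))).toNat : ℤ) - mult xs M := by
  induction xs generalizing M with
  | nil =>
    have : (Ideal.ofList ([] : List R) • ⊤ : Submodule R M) = ⊥ := by simp
    simp [excess, mult, (Submodule.quotEquivOfEqBot _ this).length_eq]
  | cons x xs ih =>
    simp only [excess, mult]
    rw [ih, (quotientConsEquiv x xs).length_eq]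
    ring

lemma excess_append_singleton_congr {zs : List R} {a b : R}
    (h : a - b ∈ Ideal.ofList zs ⊔ Module.annihilator R M) :
    excess (zs ++ [a]) M = excess (zs ++ [b]) M := by
  have key : ∀ a b : R, a - b ∈ Ideal.ofList zs ⊔ Module.annihilator R M →
      Ideal.ofList (zs ++ [a]) ⊔ Module.annihilator R M ≤
        Ideal.ofList (zs ++ [b]) ⊔ Module.annihilator R M := by
    intro a b h
    rw [Ideal.ofList_append, Ideal.ofList_append, Ideal.ofList_singleton, Ideal.ofList_singleton]
    refine sup_le (sup_le (le_sup_left.trans le_sup_left) ?_) le_sup_right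
    rw [Ideal.span_singleton_le_iff_mem, ← sub_add_cancel a b]
    exact add_mem (sup_le_sup_right (le_sup_left : _ ≤ Ideal.ofList zs ⊔ Ideal.span {b}) _ h)
      (Ideal.mem_sup_left (Ideal.mem_sup_right (Ideal.mem_span_singleton_self b)))
  have h' : b - a ∈ Ideal.ofList zs ⊔ Module.annihilator R M := by
    rw [← neg_sub]; exact neg_mem h
  have e := pow_smul_top_congr (M := M) (le_antisymm (key a b h) (key b a h')) 1
  rw [pow_one, pow_one] at e
  rw [excess_eq, excess_eq, mult_append_singleton_congr h, e]

lemma length_ker_lsmul_mul_le (a b : R) :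
    Module.length R (LinearMap.ker (LinearMap.lsmul R M (a * b))) ≤
      Module.length R (LinearMap.ker (LinearMap.lsmul R M a)) +
        Module.length R (LinearMap.ker (LinearMap.lsmul R M b)) := by
  let f : LinearMap.ker (LinearMap.lsmul R M a) →ₗ[R] LinearMap.ker (LinearMap.lsmul R M (a * b)) :=
    Submodule.inclusion (fun m hm => by
      rw [mem_ker_lsmul] at *
      rw [mul_comm, mul_smul, hm, smul_zero])
  let g : LinearMap.ker (LinearMap.lsmul R M (a * b)) →ₗ[R] LinearMap.ker (LinearMap.lsmul R M b) :=
    (LinearMap.lsmul R M a).restrict (fun m hm => by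
      rw [mem_ker_lsmul] at *
      rw [LinearMap.lsmul_apply, smul_smul, mul_comm, hm])
  rw [Module.length_eq_add_of_exact f g.rangeRestrict (Submodule.inclusion_injective _)
    g.surjective_rangeRestrict]
  · exact add_le_add_right
      (Module.length_le_of_injective (LinearMap.range g).subtype (Submodule.subtype_injective _)) _
  · rintro ⟨m, hm⟩
    constructor
    · intro h
      exact ⟨⟨m, congrArg Subtype.val (congrArg Subtype.val h)⟩, rfl⟩
    · rintro ⟨⟨n, hn⟩, h⟩
      rw [← h]
      exact Subtype.ext (Subtype.ext hn)

variable [IsLocalRing R] [IsNoetherianRing R]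

lemma excess_perm {xs ys : List R} (hp : xs.Perm ys) (h : IsParam xs M) :
    excess xs M = excess ys M := by
  rw [excess_eq, excess_eq, mult_perm hp h, ofList_perm hp]

omit [IsNoetherianRing R] in
lemma IsParam.append_singleton_of_dvd {zs : List R} {a b : R} (h : IsParam (zs ++ [b]) M)
    (hab : a ∣ b) : IsParam (zs ++ [a]) M := by
  refine h.mono (le_trans ?_ le_sup_left)
  rw [Ideal.ofList_append, Ideal.ofList_append, Ideal.ofList_singleton, Ideal.ofList_singleton]
  exact sup_le_sup_left (Ideal.span_singleton_le_span_singleton.2 hab) _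

lemma mult_append_mul {zs : List R} {a b : R} (h : IsParam (zs ++ [a * b]) M) :
    mult (zs ++ [a * b]) M = mult (zs ++ [a]) M + mult (zs ++ [b]) M := by
  have hp : ∀ c : R, (zs ++ [c]).Perm (c :: zs) := fun c => List.perm_append_singleton c zs
  rw [mult_perm (hp _) h, mult_mul_cons (h.perm (hp _)),
    mult_perm (hp a) (h.append_singleton_of_dvd (dvd_mul_right a b)),
    mult_perm (hp b) (h.append_singleton_of_dvd (dvd_mul_left b a))]

/-- Unfolded along zs, the excess is a sum of symbols ending in the last entry, which are additive
in that entry, and the length of its kernel on M/(zs)M, which is subadditive. -/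
lemma excess_append_mul_le {zs : List R} {a b : R} (h : IsParam (zs ++ [a * b]) M) :
    excess (zs ++ [a * b]) M ≤ excess (zs ++ [a]) M + excess (zs ++ [b]) M := by
  induction zs generalizing M with
  | nil =>
    have ha := (h.append_singleton_of_dvd (dvd_mul_right a b)).ker.isFiniteLength
    have hb := (h.append_singleton_of_dvd (dvd_mul_left b a)).ker.isFiniteLength
    rw [← Module.length_ne_top_iff] at ha hb
    have hle := ENat.toNat_le_toNat (length_ker_lsmul_mul_le (M := M) a b) (by simp [ha, hb])
    rw [ENat.toNat_add ha hb] at hle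
    simp only [List.nil_append, excess, mult, zero_add]
    exact_mod_cast hle
  | cons w ws ih =>
    simp only [List.cons_append, excess]
    have h₁ := ih h.quotient
    have h₂ := mult_append_mul h.ker
    linarith

lemma excess_append_pow_le {zs : List R} {a : R} (h : IsParam (zs ++ [a]) M) (t : ℕ) :
    excess (zs ++ [a ^ (t + 1)]) M ≤ (t + 1 : ℕ) * excess (zs ++ [a]) M := by
  have hpow : ∀ t, IsParam (zs ++ [a ^ (t + 1)]) M := fun t => by
    have := h.finite
    obtain ⟨k, hk⟩ := h.exists_pow_le
    rw [Ideal.ofList_append, Ideal.ofList_singleton, sup_right_comm, sup_comm] at hk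
    refine ⟨h.finite, k * (t + 1), ?_⟩
    rw [pow_mul, Ideal.ofList_append, Ideal.ofList_singleton, sup_right_comm]
    refine (Ideal.pow_right_mono hk _).trans ((sup_pow_le_pow_sup _ _ _).trans ?_)
    rw [Ideal.span_singleton_pow, sup_comm]
  induction t with
  | zero => simp
  | succ t ih =>
    have := hpow (t + 1)
    rw [pow_succ] at this ⊢
    refine (excess_append_mul_le this).trans ?_
    push_cast at ih ⊢
    linarith

variable [Infinite (ResidueField R)]

/-- The difference is the symbol with last entry b: zero if b is a unit, nonnegative by Samuel
otherwise. -/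
lemma mult_append_le_of_mul {zs : List R} {a b : R} (h : IsParam (zs ++ [a * b]) M)
    (hzs : ∀ z ∈ zs, z ∈ maximalIdeal R) : mult (zs ++ [a]) M ≤ mult (zs ++ [a * b]) M := by
  have hb := h.append_singleton_of_dvd (dvd_mul_left b a)
  rw [mult_append_mul h, le_add_iff_nonneg_right]
  by_cases hu : IsUnit b
  · rw [mult_perm (List.perm_append_singleton b zs) hb, mult_cons_eq_zero_of_isUnit hu]
  · refine mult_nonneg hb fun z hz => ?_
    rcases List.mem_append.1 hz with hz | hz
    · exact hzs z hz
    · rw [List.mem_singleton.1 hz]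
      exact (IsLocalRing.mem_maximalIdeal _).2 hu

lemma excess_append_le_of_mul {zs : List R} {a b : R} (h : IsParam (zs ++ [a * b]) M)
    (hzs : ∀ z ∈ zs, z ∈ maximalIdeal R) : excess (zs ++ [a]) M ≤ excess (zs ++ [a * b]) M := by
  induction zs generalizing M with
  | nil =>
    have hab := Module.length_ne_top_iff.2 h.ker.isFiniteLength
    have hle : Module.length R (LinearMap.ker (LinearMap.lsmul R M a)) ≤
        Module.length R (LinearMap.ker (LinearMap.lsmul R M (a * b))) :=
      Module.length_le_of_injective (Submodule.inclusion (fun m hm => by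
        rw [mem_ker_lsmul] at *
        rw [mul_comm, mul_smul, hm, smul_zero])) (Submodule.inclusion_injective _)
    simp only [List.nil_append, excess, mult, zero_add]
    exact_mod_cast ENat.toNat_le_toNat hle hab
  | cons w ws ih =>
    simp only [List.cons_append, excess]
    have hws : ∀ z ∈ ws, z ∈ maximalIdeal R := fun z hz => hzs z (List.mem_cons_of_mem _ hz)
    exact add_le_add (ih h.quotient hws) (mult_append_le_of_mul h.ker hws)

/-- The chain is b ≤ b r = a^(t+1) ≤ (t+1) · a for the excess as a function of the last entry:
monotonicity, congruence modulo zs, subadditivity. -/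
lemma excess_append_singleton_le {zs : List R} {a b r : R} {t : ℕ} (ha : IsParam (zs ++ [a]) M)
    (hzs : ∀ z ∈ zs, z ∈ maximalIdeal R) (h : a ^ (t + 1) - b * r ∈ Ideal.ofList zs) :
    excess (zs ++ [b]) M ≤ (t + 1 : ℕ) * excess (zs ++ [a]) M := by
  have hpow : IsParam (zs ++ [b * r]) M := by
    have := ha.finite
    obtain ⟨k, hk⟩ := ha.exists_pow_le
    rw [Ideal.ofList_append, Ideal.ofList_singleton, sup_right_comm, sup_comm] at hk
    refine ⟨ha.finite, k * (t + 1), ?_⟩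
    rw [pow_mul, Ideal.ofList_append, Ideal.ofList_singleton]
    refine (Ideal.pow_right_mono hk _).trans ((sup_pow_le_pow_sup _ _ _).trans ?_)
    rw [Ideal.span_singleton_pow]
    refine sup_le ?_ (sup_le_sup_right le_sup_left _)
    rw [Ideal.span_singleton_le_iff_mem, ← sub_add_cancel (a ^ (t + 1)) (b * r)]
    exact Ideal.mem_sup_left (add_mem (Ideal.mem_sup_left h)
      (Ideal.mem_sup_right (Ideal.mem_span_singleton_self _)))
  calc excess (zs ++ [b]) M ≤ excess (zs ++ [b * r]) M := excess_append_le_of_mul hpow hzs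
    _ = excess (zs ++ [a ^ (t + 1)]) M :=
      (excess_append_singleton_congr (Ideal.mem_sup_left h)).symm
    _ ≤ _ := excess_append_pow_le ha t

/-- The excess of a list of parameters is bounded by a constant multiple of that of any list to
which it is linked by successive exchanges, uniformly in the module. -/
theorem exists_excess_le {pre xs ys : List R} (hpre : ∀ z ∈ pre, z ∈ maximalIdeal R)
    (hxs : ∀ z ∈ xs, z ∈ maximalIdeal R) (hys : ∀ z ∈ ys, z ∈ maximalIdeal R)
    (hex : IsExchange (Ideal.ofList pre) xs ys)
    (hp : ∃ k, maximalIdeal R ^ k ≤ Ideal.ofList pre ⊔ Ideal.ofList xs) :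
    ∃ C : ℕ, ∀ (M : Type v) [AddCommGroup M] [Module R M] [Module.Finite R M],
      excess (pre ++ ys) M ≤ C * excess (pre ++ xs) M := by
  induction xs generalizing pre ys with
  | nil =>
    obtain rfl : ys = [] := hex
    exact ⟨1, fun M _ _ _ => by simp⟩
  | cons x xs ih =>
    obtain ⟨y, ys, rfl, ⟨k, hk⟩, hex⟩ := hex
    have hpy : Ideal.ofList (pre ++ [y]) = Ideal.ofList pre ⊔ Ideal.span {y} := by
      rw [Ideal.ofList_append, Ideal.ofList_singleton]
    simp only [List.mem_cons, forall_eq_or_imp] at hxs hys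
    obtain ⟨C, hC⟩ := ih (pre := pre ++ [y]) (ys := ys)
      (by simpa [or_imp, forall_and] using ⟨hpre, hys.1⟩) hxs.2 hys.2 (by rwa [hpy])
      ⟨k, by rwa [hpy]⟩
    -- The exchange condition makes a power of x a multiple of y modulo the other entries. The
    -- exponent comes from the ring alone, which makes the constant uniform in M.
    have hx : x ^ (k + 1) ∈ Ideal.ofList (pre ++ xs) ⊔ Ideal.span {y} := by
      rw [Ideal.ofList_append, sup_right_comm]
      exact hk (Ideal.pow_le_pow_right (Nat.le_succ k) (Ideal.pow_mem_pow hxs.1 _))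
    obtain ⟨s, hs, w, hw, hsw⟩ := Submodule.mem_sup.1 hx
    obtain ⟨r, rfl⟩ := Ideal.mem_span_singleton.1 hw
    have hperm : ∀ c : R, ((pre ++ xs) ++ [c]).Perm (pre ++ c :: xs) := fun c =>
      (List.perm_append_singleton c _).trans List.perm_middle.symm
    refine ⟨C * (k + 1), fun M _ _ _ => ?_⟩
    have hparam : IsParam ((pre ++ xs) ++ [x]) M := by
      obtain ⟨l, hl⟩ := hp
      refine IsParam.perm (xs := pre ++ x :: xs) ⟨inferInstance, l, ?_⟩ (hperm x).symm
      rw [Ideal.ofList_append]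
      exact hl.trans le_sup_left
    have hparam' : IsParam ((pre ++ xs) ++ [y]) M := by
      refine ⟨inferInstance, k, ?_⟩
      rw [Ideal.ofList_append, Ideal.ofList_append, Ideal.ofList_singleton,
        sup_right_comm _ _ (Ideal.span _)]
      exact hk.trans le_sup_left
    have h₁ : excess ((pre ++ xs) ++ [y]) M ≤ (k + 1 : ℕ) * excess ((pre ++ xs) ++ [x]) M :=
      excess_append_singleton_le (r := r) hparam (by
        simpa [or_imp, forall_and] using ⟨hpre, hxs.2⟩) (by rw [← hsw]; simpa using hs)
    rw [excess_perm (hperm x) hparam, excess_perm (hperm y) hparam'] at h₁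
    have h₂ := hC M
    simp only [List.append_assoc, List.singleton_append] at h₂
    refine h₂.trans ?_
    have := mul_le_mul_of_nonneg_left h₁ (Int.natCast_nonneg C)
    rw [← mul_assoc] at this
    exact_mod_cast this

end Excess

/-! ### Koszul homology: χ₁ is the excess. -/

section Koszul

variable {R : Type u} [CommRing R]

lemma function_exact_of_iso {S : ShortComplex (ModuleCat.{v} R)} (hS : S.Exact)
    {A B C : ModuleCat.{v} R} (i₁ : S.X₁ ≅ A) (i₂ : S.X₂ ≅ B) (i₃ : S.X₃ ≅ C)
    (f : A ⟶ B) (g : B ⟶ C) (hf : i₁.hom ≫ f = S.f ≫ i₂.hom) (hg : i₂.hom ≫ g = S.g ≫ i₃.hom) :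
    Function.Exact f.hom g.hom := by
  have w : f ≫ g = 0 := by
    rw [← cancel_epi i₁.hom, reassoc_of% hf, hg, S.zero_assoc, Limits.zero_comp, Limits.comp_zero]
  exact (ShortComplex.ShortExact.moduleCat_exact_iff_function_exact (.mk f g w)).mp
    (ShortComplex.exact_of_iso (ShortComplex.isoMk i₁ i₂ i₃ hf hg) hS)

open CochainComplex HomotopyCategory in
-- This is the long exact sequence of the distinguished triangle of the cone in the homotopy
-- category, transported to complexes by `homologyFunctorFactors`.
lemma exists_mappingCone_homology_exact {K L : CochainComplex (ModuleCat.{v} R) ℤ} (φ : K ⟶ L)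
    (n m : ℤ) (h : n + 1 = m) :
    ∃ δ : (mappingCone φ).homology n ⟶ K.homology m,
      Function.Exact (HomologicalComplex.homologyMap φ n).hom
        (HomologicalComplex.homologyMap (mappingCone.inr φ) n).hom ∧
      Function.Exact (HomologicalComplex.homologyMap (mappingCone.inr φ) n).hom δ.hom ∧
      Function.Exact δ.hom (HomologicalComplex.homologyMap φ m).hom := by
  let F := homologyFunctor (ModuleCat.{v} R) (ComplexShape.up ℤ) 0
  let e := fun i => homologyFunctorFactors (ModuleCat.{v} R) (ComplexShape.up ℤ) i
  let T := mappingCone.triangleh φ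
  have hT := mappingCone_triangleh_distinguished φ
  have e₁ (i : ℤ) := ((e i).hom.naturality φ).symm
  have e₂ := ((e n).hom.naturality (mappingCone.inr φ)).symm
  have e₃ := Iso.hom_inv_id_app_assoc (e n) (mappingCone φ)
    (F.homologySequenceδ T n m h ≫ (e m).hom.app K)
  exact ⟨(e n).inv.app (mappingCone φ) ≫ F.homologySequenceδ T n m h ≫ (e m).hom.app K,
    function_exact_of_iso (F.homologySequence_exact₂ T hT n) ((e n).app K) ((e n).app L)
      ((e n).app (mappingCone φ)) _ _ (e₁ n) e₂,
    function_exact_of_iso (F.homologySequence_exact₃ T hT n m h) ((e n).app L)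
      ((e n).app (mappingCone φ)) ((e m).app K) _ _ e₂ e₃,
    function_exact_of_iso (F.homologySequence_exact₁ T hT n m h) ((e n).app (mappingCone φ))
      ((e m).app K) ((e m).app L) _ _ e₃ (e₁ m)⟩

lemma homologyMap_smul_id (K : CochainComplex (ModuleCat.{v} R) ℤ) (x : R) (n : ℤ) :
    HomologicalComplex.homologyMap (x • 𝟙 K) n = x • 𝟙 (K.homology n) := by
  have h : (HomologicalComplex.shortComplexFunctor (ModuleCat.{v} R) (ComplexShape.up ℤ) n).map
      (x • 𝟙 K) = x • 𝟙 (K.sc n) := by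
    ext <;> rfl
  change ShortComplex.homologyMap _ = _
  rw [h, ShortComplex.homologyMap_smul, ShortComplex.homologyMap_id]
  rfl

lemma homologyMap_smul_id_hom (K : CochainComplex (ModuleCat.{v} R) ℤ) (x : R) (n : ℤ) :
    (HomologicalComplex.homologyMap (x • 𝟙 K) n).hom = LinearMap.lsmul R (K.homology n) x := by
  rw [homologyMap_smul_id]
  rfl

section

variable {A B C : Type*} [AddCommGroup A] [Module R A] [AddCommGroup B] [Module R B]
  [AddCommGroup C] [Module R C]

lemma exists_shortExact_of_exact (a : A →ₗ[R] A) (b : A →ₗ[R] B) (c : B →ₗ[R] C) (d : C →ₗ[R] C)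
    (hab : Function.Exact a b) (hbc : Function.Exact b c) (hcd : Function.Exact c d) :
    ∃ (f : (A ⧸ LinearMap.range a) →ₗ[R] B) (g : B →ₗ[R] LinearMap.ker d),
      Function.Injective f ∧ Function.Surjective g ∧ Function.Exact f g := by
  have hc (y : B) : c y ∈ LinearMap.ker d := (hcd (c y)).2 ⟨y, rfl⟩
  have ha : LinearMap.range a ≤ LinearMap.ker b := fun z hz => (hab z).2 hz
  refine ⟨(LinearMap.range a).liftQ b ha, c.codRestrict _ hc, ?_, ?_, ?_⟩
  · rw [← LinearMap.ker_eq_bot]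
    exact Submodule.ker_liftQ_eq_bot _ _ _ fun z hz => (hab z).1 hz
  · rintro ⟨z, hz⟩
    obtain ⟨y, rfl⟩ := (hcd z).1 hz
    exact ⟨y, rfl⟩
  · intro y
    rw [← LinearMap.coe_range, Submodule.range_liftQ, LinearMap.coe_range, ← hbc y]
    exact Subtype.ext_iff

end

/-- The cone sequence of multiplication by x breaks up into 0 → H_i/xH_i → H_i(x, xs) → (0
:_{H_{i-1}} x) → 0, with i = -n. -/
lemma exists_koszulComplex_cons_shortExact (M : ModuleCat.{v} R) (x : R) (xs : List R) (n : ℤ) :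
    ∃ (f : ((koszulComplex M xs).homology n ⧸
          LinearMap.range (LinearMap.lsmul R ((koszulComplex M xs).homology n) x)) →ₗ[R]
        (koszulComplex M (x :: xs)).homology n)
      (g : (koszulComplex M (x :: xs)).homology n →ₗ[R]
        LinearMap.ker (LinearMap.lsmul R ((koszulComplex M xs).homology (n + 1)) x)),
      Function.Injective f ∧ Function.Surjective g ∧ Function.Exact f g := by
  obtain ⟨δ, h₁, h₂, h₃⟩ :=
    exists_mappingCone_homology_exact (x • 𝟙 (koszulComplex M xs)) n (n + 1) rfl
  rw [homologyMap_smul_id_hom] at h₁ h₃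
  exact exists_shortExact_of_exact _ _ _ _ h₁ h₂ h₃

lemma subsingleton_of_exact {A B C : Type*} [AddCommGroup A] [Module R A] [AddCommGroup B]
    [Module R B] [AddCommGroup C] [Module R C] [Subsingleton A] [Subsingleton C]
    (f : A →ₗ[R] B) (g : B →ₗ[R] C) (h : Function.Exact f g) : Subsingleton B :=
  subsingleton_of_forall_eq 0 fun b => by
    obtain ⟨a, rfl⟩ := (h b).1 (Subsingleton.elim _ _)
    rw [Subsingleton.elim a 0, map_zero]

lemma subsingleton_koszulComplex_homology (M : ModuleCat.{v} R) (xs : List R) (n : ℤ)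
    (hn : 0 < n ∨ n < -(xs.length : ℤ)) : Subsingleton ((koszulComplex M xs).homology n) := by
  induction xs generalizing n with
  | nil =>
    refine ModuleCat.subsingleton_of_isZero (HomologicalComplex.isZero_single_obj_homology _ _ M n ?_)
    simp at hn
    omega
  | cons x xs ih =>
    rw [List.length_cons] at hn
    obtain ⟨f, g, -, -, h⟩ := exists_koszulComplex_cons_shortExact M x xs n
    have := ih n (by omega)
    have := ih (n + 1) (by omega)
    exact subsingleton_of_exact f g h

noncomputable def koszulComplexNilHomologyEquiv (M : ModuleCat.{v} R) :
    (koszulComplex M []).homology 0 ≃ₗ[R] M :=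
  (HomologicalComplex.singleObjHomologySelfIso (ComplexShape.up ℤ) 0 M).toLinearEquiv

lemma nonempty_koszulComplex_homology_zero_equiv (M : ModuleCat.{v} R) (xs : List R) :
    Nonempty ((koszulComplex M xs).homology 0 ≃ₗ[R] M ⧸ (Ideal.ofList xs • ⊤ : Submodule R M)) := by
  induction xs with
  | nil =>
    exact ⟨(koszulComplexNilHomologyEquiv M).trans (Submodule.quotEquivOfEqBot _ (by simp)).symm⟩
  | cons x xs ih =>
    obtain ⟨e⟩ := ih
    obtain ⟨f, g, hf, -, h⟩ := exists_koszulComplex_cons_shortExact M x xs 0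
    have := subsingleton_koszulComplex_homology M xs (0 + 1) (by omega)
    have hf' : Function.Surjective f := fun y => (h y).1 (Subsingleton.elim _ _)
    have hS : (LinearMap.range (LinearMap.lsmul R ((koszulComplex M xs).homology 0) x)).map
        e.toLinearMap = (LinearMap.range (LinearMap.lsmul R M x)).map
        (Ideal.ofList xs • ⊤ : Submodule R M).mkQ := by
      rw [← LinearMap.range_comp, ← LinearMap.range_comp]
      have h₁ : e.toLinearMap ∘ₗ LinearMap.lsmul R ((koszulComplex M xs).homology 0) x =
          LinearMap.lsmul R _ x ∘ₗ e.toLinearMap := by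
        ext; simp
      have h₂ : (Ideal.ofList xs • ⊤ : Submodule R M).mkQ ∘ₗ LinearMap.lsmul R M x =
          LinearMap.lsmul R _ x ∘ₗ (Ideal.ofList xs • ⊤ : Submodule R M).mkQ := by
        ext; simp
      rw [h₁, h₂, LinearMap.range_comp, LinearMap.range_comp, LinearEquiv.range,
        Submodule.range_mkQ]
    refine ⟨(LinearEquiv.ofBijective f ⟨hf, hf'⟩).symm.trans
      ((Submodule.Quotient.equiv _ _ e hS).trans
        ((Submodule.quotientQuotientEquivQuotientSup _ _).trans
          (Submodule.quotEquivOfEq _ _ ?_)))⟩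
    rw [Ideal.ofList_cons, Submodule.sup_smul, sup_comm, Submodule.ideal_span_singleton_smul]
    congr 1
    ext; simp [Submodule.mem_smul_pointwise_iff_exists]

section Local

variable [IsLocalRing R] [IsNoetherianRing R]

/-- The tail ys holds the parameters not yet used by the complex and makes the induction run; for
empty ys this is finite length of the homology. -/
lemma IsParam.koszulComplex_homology (M : ModuleCat.{v} R) (xs : List R) {ys : List R}
    (h : IsParam (xs ++ ys) M) (n : ℤ) : IsParam ys ((koszulComplex M xs).homology n) := by
  induction xs generalizing ys n with
  | nil =>
    by_cases hn : n = 0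
    · subst hn
      exact IsParam.of_injective h _ (koszulComplexNilHomologyEquiv M).injective
    · have := subsingleton_koszulComplex_homology M [] n (by simp; omega)
      exact IsParam.of_injective h 0 (Function.injective_of_subsingleton _)
  | cons x xs ih =>
    have h' : IsParam (xs ++ x :: ys) M := h.perm List.perm_middle.symm
    obtain ⟨f, g, -, hg, hfg⟩ := exists_koszulComplex_cons_shortExact M x xs n
    exact IsParam.of_exact (ih h' n).quotient (ih h' (n + 1)).ker f g hg hfg

/-- Interpolates between the symbol (xs empty) and the Euler characteristic (ys empty). Moving x
from tail to complex splits each H_i(x, xs) as above, and the alternating sum regroups into quotient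
minus kernel of each H_i(xs), which is the symbol of x :: ys. -/
theorem sum_mult_koszulComplex_homology (M : ModuleCat.{v} R) (xs : List R) {ys : List R}
    (h : IsParam (xs ++ ys) M) :
    ∑ i ∈ Finset.range (xs.length + 1),
      (-1 : ℤ) ^ i * mult ys ((koszulComplex M xs).homology (-(i : ℤ))) = mult (xs ++ ys) M := by
  induction xs generalizing ys with
  | nil => simpa using mult_congr (koszulComplexNilHomologyEquiv M) h
  | cons x xs ih =>
    have h' : IsParam (xs ++ x :: ys) M := h.perm List.perm_middle.symm
    rw [List.cons_append, ← mult_perm List.perm_middle h', ← ih h', List.length_cons]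
    have key (n : ℤ) : mult ys ((koszulComplex M (x :: xs)).homology n) =
        mult ys ((koszulComplex M xs).homology n ⧸
          LinearMap.range (LinearMap.lsmul R ((koszulComplex M xs).homology n) x)) +
        mult ys (LinearMap.ker (LinearMap.lsmul R ((koszulComplex M xs).homology (n + 1)) x)) := by
      obtain ⟨f, g, hf, hg, hfg⟩ := exists_koszulComplex_cons_shortExact M x xs n
      exact mult_eq_add f g (h.koszulComplex_homology M (x :: xs) n) hf hg hfg
    simp only [key, mul_add, Finset.sum_add_distrib]
    -- The two sums are shifted by one against each other; their unmatched end terms come from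
    -- degrees where the homology vanishes.
    have := subsingleton_koszulComplex_homology M xs (-((xs.length + 1 : ℕ) : ℤ)) (by omega)
    have h₁ := subsingleton_koszulComplex_homology M xs (-((0 : ℕ) : ℤ) + 1) (by omega)
    rw [Finset.sum_range_succ, Finset.sum_range_succ' _ (xs.length + 1),
      mult_eq_zero_of_subsingleton, mult_eq_zero_of_subsingleton, mul_zero, add_zero, mul_zero,
      add_zero, ← Finset.sum_add_distrib]
    refine Finset.sum_congr rfl fun i _ => ?_
    have hi : (-((i + 1 : ℕ) : ℤ) + 1) = -(i : ℤ) := by push_cast; ring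
    rw [hi, mult, pow_succ]
    ring

/-- Removing H₀ = M/(xs)M from the full Euler characteristic e(xs|M) and changing sign leaves χ₁. -/
theorem chiOne_eq_excess (xs : List R) (M : Type v) [AddCommGroup M] [Module R M]
    (h : IsParam xs M) : chiOne xs M = excess xs M := by
  have hs := sum_mult_koszulComplex_homology (ModuleCat.of R M) xs (ys := []) (by simpa using h)
  obtain ⟨e⟩ := nonempty_koszulComplex_homology_zero_equiv (ModuleCat.of R M) xs
  rw [List.append_nil, Finset.sum_range_succ', pow_zero, one_mul] at hs
  have h₀ : mult ([] : List R) ((koszulComplex (ModuleCat.of R M) xs).homology (-((0 : ℕ) : ℤ))) =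
      ((Module.length R (M ⧸ (Ideal.ofList xs • ⊤ : Submodule R M))).toNat : ℤ) := by
    exact congrArg (fun l : ℕ∞ => (l.toNat : ℤ)) e.length_eq
  rw [h₀] at hs
  rw [excess_eq, ← hs, chiOne, ← Finset.Ico_add_one_right_eq_Icc, Finset.sum_Ico_eq_sum_range]
  simp only [mult, koszulHomology, pow_succ, Nat.add_sub_cancel_left, mul_neg,
    mul_one, neg_mul, Finset.sum_neg_distrib, sub_add_cancel_right, neg_neg]
  exact Finset.sum_congr rfl fun i _ => by rw [add_comm 1 i]; rfl

end Local

end Koszul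

/-! ### Comparison of ν, e(𝔪, M) and χ₁. -/

section Comparison

variable {R : Type u} [CommRing R]

lemma nu_pos {M : Type v} [AddCommGroup M] [Module R M] [Module.Finite R M] [Nontrivial M] : 0 < nu R M := by
  rw [Nat.pos_iff_ne_zero, nu, Ne, Submodule.spanFinrank_eq_zero_iff_eq_bot Module.Finite.fg_top]
  exact top_ne_bot

variable [IsLocalRing R]

lemma IsExchange.length_eq {J : Ideal R} {xs ys : List R} (h : IsExchange J xs ys) :
    ys.length = xs.length := by
  induction xs generalizing J ys with
  | nil => rw [show ys = [] from h]
  | cons x xs ih =>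
    obtain ⟨y, ys, rfl, -, h⟩ := h
    rw [List.length_cons, List.length_cons, ih h]

lemma ofList_le_maximalIdeal {zs : List R} (hm : ∀ z ∈ zs, z ∈ maximalIdeal R) :
    Ideal.ofList zs ≤ maximalIdeal R :=
  Ideal.span_le.2 hm

lemma IsParam.of_exists_pow_le {zs : List R} (h : ∃ k, maximalIdeal R ^ k ≤ Ideal.ofList zs)
    (M : Type v) [AddCommGroup M] [Module R M] [hM : Module.Finite R M] : IsParam zs M :=
  ⟨hM, h.imp fun _ hk => hk.trans le_sup_left⟩

lemma IsSystemOfParameters.mem_maximalIdeal {xs : List R} (h : IsSystemOfParameters xs) :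
    ∀ x ∈ xs, x ∈ maximalIdeal R := fun x hx => by
  rw [← h.2]
  exact Ideal.le_radical (Ideal.subset_span hx)

lemma IsSystemOfParameters.ringDim_eq {xs : List R} (h : IsSystemOfParameters xs) :
    ringDim R = xs.length := by
  rw [ringDim, ← h.1]
  rfl

/-- By Nakayama ν(M) = ℓ(M/𝔪M), and M/𝔪M is a quotient of M/IM. -/
lemma nu_le_length_quotient {M : Type v} [AddCommGroup M] [Module R M] [Module.Finite R M]
    {I : Ideal R} (hI : I ≤ maximalIdeal R) :
    (nu R M : ℕ∞) ≤ Module.length R (M ⧸ (I • ⊤ : Submodule R M)) := by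
  let T : Submodule R M := ⊤
  let N : Submodule R T := maximalIdeal R • ⊤
  have h₁ : nu R M = Module.finrank (R ⧸ maximalIdeal R) (T ⧸ N) :=
    IsLocalRing.spanFinrank_eq_finrank_quotient T Module.Finite.fg_top
  have h₂ : (nu R M : ℕ∞) = Module.length R (T ⧸ N) := by
    let : Field (R ⧸ maximalIdeal R) := Ideal.Quotient.field _
    have : Module.Finite (R ⧸ maximalIdeal R) (T ⧸ N) :=
      Module.Finite.of_restrictScalars_finite R _ _
    rw [h₁, ← Module.length_eq_finrank]
    exact (Module.length_eq_of_surjective Ideal.Quotient.mk_surjective).symm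
  rw [h₂]
  have hle : (I • ⊤ : Submodule R M) ≤ N.comap Submodule.topEquiv.symm.toLinearMap := by
    rw [← Submodule.map_le_iff_le_comap, Submodule.map_smul'']
    exact Submodule.smul_mono hI le_top
  refine Module.length_le_of_surjective
    (Submodule.mapQ _ N Submodule.topEquiv.symm.toLinearMap hle) fun y => ?_
  obtain ⟨t, rfl⟩ := N.mkQ_surjective y
  exact ⟨Submodule.Quotient.mk (t : M), rfl⟩

variable [IsNoetherianRing R] {M : Type v} [AddCommGroup M] [Module R M]

lemma IsParam.hilbertFn_le_hilbertFn {zs : List R} (h : IsParam zs M) {I J : Ideal R}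
    (hI : Ideal.ofList zs ≤ I) (hJ : Ideal.ofList zs ≤ J) {k l : ℕ} (hle : I ^ k ≤ J ^ l) :
    hilbertFn J M l ≤ hilbertFn I M k := by
  rw [← Nat.cast_le (α := ℕ∞), h.coe_hilbertFn hI, h.coe_hilbertFn hJ]
  exact Module.length_le_of_surjective
    (Submodule.factor (Submodule.smul_mono_left hle)) (Submodule.factor_surjective _)

lemma IsParam.exists_hilbertFn_maximalIdeal_le [Infinite (ResidueField R)] {zs : List R}
    (h : IsParam zs M) (hm : ∀ z ∈ zs, z ∈ maximalIdeal R) :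
    ∃ C : ℕ, ∀ᶠ k in atTop, hilbertFn (maximalIdeal R) M k ≤ C * k ^ zs.length := by
  obtain ⟨C, hC⟩ := exists_nat_gt (mult zs M : ℝ)
  refine ⟨C, ?_⟩
  filter_upwards [(tendsto_hilbertFn h hm).eventually_lt_const hC, eventually_gt_atTop 0]
    with k hk hpos
  have hle := h.hilbertFn_le_hilbertFn le_rfl (ofList_le_maximalIdeal hm) (k := k) (l := k)
    (Ideal.pow_right_mono (ofList_le_maximalIdeal hm) k)
  refine hle.trans ?_
  rw [div_lt_iff₀ (by positivity)] at hk
  have hf : (1 : ℝ) ≤ zs.length.factorial := by exact_mod_cast zs.length.factorial_pos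
  have : (hilbertFn (Ideal.ofList zs) M k : ℝ) ≤ C * (k : ℝ) ^ zs.length :=
    (le_mul_of_one_le_left (Nat.cast_nonneg _) hf).trans hk.le
  exact_mod_cast this

/-- Over an ideal generated by parameters that is a reduction of the maximal ideal, the
multiplicity symbol is the Hilbert--Samuel multiplicity of the maximal ideal. -/
theorem IsParam.tendsto_hilbertFn_maximalIdeal [Infinite (ResidueField R)] {zs : List R}
    (h : IsParam zs M) (hm : ∀ z ∈ zs, z ∈ maximalIdeal R) {n₀ : ℕ}
    (hred : ∀ k, maximalIdeal R ^ (n₀ + k) ≤ Ideal.ofList zs ^ k) :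
    Tendsto (fun k : ℕ => (zs.length.factorial : ℝ) * hilbertFn (maximalIdeal R) M k /
      (k : ℝ) ^ zs.length) atTop (𝓝 (mult zs M : ℝ)) := by
  have hle := ofList_le_maximalIdeal hm
  have hT := tendsto_hilbertFn h hm
  rw [← tendsto_add_atTop_iff_nat n₀]
  -- Squeeze by (zs)^(k+n₀) ⊆ 𝔪^(k+n₀) ⊆ (zs)^k; the factor (k/(k+n₀))^d corrects the denominator of
  -- the lower bound and tends to 1.
  refine tendsto_of_tendsto_of_tendsto_of_le_of_le'
    (g := fun k : ℕ => (zs.length.factorial : ℝ) * hilbertFn (Ideal.ofList zs) M k /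
      (k : ℝ) ^ zs.length * ((k : ℝ) / (k + n₀)) ^ zs.length) ?_
    ((tendsto_add_atTop_iff_nat n₀).2 hT) ?_ ?_
  · simpa using hT.mul ((tendsto_natCast_div_add_atTop (n₀ : ℝ)).pow zs.length)
  · filter_upwards [eventually_gt_atTop 0] with k hk
    have hk' : (0 : ℝ) < k := by exact_mod_cast hk
    rw [div_pow, div_mul_div_cancel₀ (by positivity), Nat.cast_add]
    gcongr
    exact h.hilbertFn_le_hilbertFn hle le_rfl (by rw [add_comm]; exact hred k)
  · filter_upwards with k
    gcongr
    exact h.hilbertFn_le_hilbertFn le_rfl hle (Ideal.pow_right_mono hle _)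

lemma nu_sub_excess_le_mult {zs : List R} (h : IsParam zs M)
    (hm : ∀ z ∈ zs, z ∈ maximalIdeal R) : (nu R M : ℤ) - excess zs M ≤ mult zs M := by
  have := h.finite
  have hle := nu_le_length_quotient (M := M) (ofList_le_maximalIdeal hm)
  have hfin := h.isFiniteLength_quotient le_rfl 1
  rw [pow_one] at hfin
  rw [← ENat.natCast_toNat (Module.length_ne_top_iff.2 hfin), Nat.cast_le] at hle
  rw [excess_eq]
  omega

lemma IsSystemOfParameters.exists_pow_le {xs : List R} (h : IsSystemOfParameters xs) :
    ∃ k, maximalIdeal R ^ k ≤ Ideal.ofList xs :=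
  Ideal.exists_pow_le_of_le_radical_of_fg h.2.ge (IsNoetherian.noetherian _)

/-- The Hilbert--Samuel multiplicity is at least the number of generators, up to a multiple of
the first higher Euler characteristic that does not depend on the module. -/
theorem IsSystemOfParameters.exists_nu_sub_le [Infinite (ResidueField R)] {xs : List R}
    (h : IsSystemOfParameters xs) :
    ∃ C : ℕ, ∀ (M : Type v) [AddCommGroup M] [Module R M] [Module.Finite R M],
      (nu R M : ℝ) - C * chiOne xs M ≤ hilbertSamuelMultiplicity (maximalIdeal R) M := by
  have hm := h.mem_maximalIdeal
  have hbot : Ideal.ofList ([] : List R) = ⊥ := Ideal.ofList_nil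
  have hJ : ∃ k, maximalIdeal R ^ k ≤ Ideal.ofList ([] : List R) ⊔ Ideal.ofList xs := by
    rw [hbot, bot_sup_eq]
    exact h.exists_pow_le
  -- The reduction is built for the module R itself, so that ys and all constants serve every M at
  -- once.
  obtain ⟨B, hB⟩ := (IsParam.of_exists_pow_le h.exists_pow_le R).exists_hilbertFn_maximalIdeal_le hm
  obtain ⟨ys, hys, hex, n₀, hn₀⟩ := exists_reduction hm _ hJ R hB
  simp only [smul_eq_mul, Ideal.mul_top] at hn₀
  have hred (k : ℕ) : maximalIdeal R ^ (n₀ + k) ≤ Ideal.ofList ys ^ k := by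
    induction k with
    | zero => simp
    | succ k ih =>
      rw [pow_succ']
      exact (hn₀ (n₀ + k) (Nat.le_add_right _ _)).trans (Ideal.mul_mono_right ih)
  obtain ⟨C, hC⟩ := exists_excess_le.{u, v} (by simp) hm hys hex hJ
  refine ⟨C, fun M _ _ _ => ?_⟩
  have hpar : IsParam ys M := IsParam.of_exists_pow_le ⟨n₀ + 1, by simpa using hred 1⟩ M
  have hlim := hpar.tendsto_hilbertFn_maximalIdeal hys hred
  rw [hex.length_eq, ← h.ringDim_eq] at hlim
  have he : hilbertSamuelMultiplicity (maximalIdeal R) M = mult ys M := hlim.limUnder_eq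
  have h₁ := nu_sub_excess_le_mult hpar hys
  have h₂ := hC M
  rw [List.nil_append, List.nil_append,
    ← chiOne_eq_excess xs M (IsParam.of_exists_pow_le h.exists_pow_le M)] at h₂
  rw [he]
  exact_mod_cast (sub_le_sub_left h₂ (nu R M : ℤ)).trans h₁

end Comparison

end LimCM

/-! ### The limit inferior. -/

theorem mainTheorem5 {R : Type*} [CommRing R] [IsNoetherianRing R] [IsLocalRing R]
    [Infinite (IsLocalRing.ResidueField R)]
    (M : ℕ → Type*) [∀ n, AddCommGroup (M n)] [∀ n, Module R (M n)]
    (hM : LimCM.IsWeaklyLimCohenMacaulay R M) :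
    (1 : EReal) ≤ Filter.liminf
      (fun n : ℕ =>
        ((LimCM.hilbertSamuelMultiplicity (IsLocalRing.maximalIdeal R) (M n) /
          (LimCM.nu R (M n) : ℝ) : ℝ) : EReal))
      Filter.atTop := by
  obtain ⟨xs, hxs, ho⟩ := hM.exists_chiOne_isLittleO
  obtain ⟨C, hC⟩ := hxs.exists_nu_sub_le
  refine EReal.ge_of_forall_gt_iff_ge.1 fun z hz => ?_
  have hz : z < 1 := by exact_mod_cast hz
  refine le_liminf_of_le (by isBoundedDefault) ?_
  -- For z < 1, eventually C |χ₁| ≤ (1 - z) ν, hence e(𝔪, M_n) ≥ ν - C χ₁ ≥ z ν.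
  filter_upwards [(ho.const_mul_left (C : ℝ)).bound (sub_pos.2 hz)] with n hn
  have := hM.finite n
  -- A zero module would make the quotient 0/0 = 0; the dimension condition excludes it.
  have : Nontrivial (M n) := by
    by_contra hnt
    rw [not_nontrivial_iff_subsingleton] at hnt
    exact ringKrullDim_ne_bot (R := R)
      ((hM.dim_eq n).symm.trans (Module.supportDim_eq_bot_of_subsingleton R (M n)))
  have hpos : (0 : ℝ) < LimCM.nu R (M n) := by exact_mod_cast LimCM.nu_pos
  rw [EReal.coe_le_coe_iff, le_div_iff₀ hpos]
  rw [Real.norm_of_nonneg hpos.le] at hn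
  linarith [hC (M n), (le_abs_self _).trans hn]
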